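/- **Friedrichs inequality for quadrilateral lattices.** A (finite) quadrilateral lattice $Q$ is a finite graph in $\mathbb{C}$ with straight edges each of whose bounded faces is a (not necessarily convex) quadrilateral, such that any two distinct bounded faces are disjoint or share exactly one vertex or exactly one edge, and such that the boundary $\partial Q$ of the outer face is a closed curve without self-intersections. Let $Q^0$ be its set of vertices. Joining the opposite vertices of each face yields two connected graphs; let $B$ be any one of them and $B^0$ its set of vertices. Let $h$ be twice the maximal edge length of $Q$. The eccentricity $e$ of $Q$ is the infimum of the numbers $c$ such that: for each face the ratio of the two diagonals (in either order) is less than $c$ and the angle between them is greater than $1/c$; and every disk of radius equal to the maximal edge length contains fewer than $c$ vertices. For $v\colon Q^0\to\mathbb{R}$ and a face $z_1z_2z_3z_4$ let $\nabla_Q v(z_1z_2z_3z_4)\in\mathbb{R}^2$ be the unique vector with $\nabla_Q v\cdot\overrightarrow{z_1z_3}=v(z_3)-v(z_1)$ and $\nabla_Q v\cdot\overrightarrow{z_2z_4}=v(z_4)-v(z_2)$, and let $$E_Q(v)=\sum_{z_1z_2z_3z_4}|\nabla_Q v(z_1z_2z_3z_4)|^2\,\mathrm{Area}(z_1z_2z_3z_4),$$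 the sum being over all bounded faces. For $M\subset\mathbb{C}$ and $u\colon B^0\to\mathbb{R}$ put $L^2_M(u)=\sum_{z\in M\cap B^0}u(z)^2$. Let $\Omega\subset\mathbb{C}$ be a bounded simply connected domain with smooth boundary. Then for each $e$ there is a constant $C_{\Omega,e}>0$, depending only on $\Omega$ and $e$, with the following property. Let $Q$ be a quadrilateral lattice of eccentricity $e$, with $B$ and $h$ as above, let $K$ be a compact subset of the closed region bounded by $\partial Q$, and let $r$ be a real number such that $\mathrm{dist}(z,\partial\Omega)\le r$ for all $z\in\Omega\setminus K$ (for instance $r=\sup_{z\in\Omega\setminus K}\mathrm{dist}(z,\partial\Omega)$ when $\Omega\setminus K\neq\emptyset$). Assume that $r>h$ and $r>\max_{z\in\partial Q}\mathrm{dist}(z,\partial\Omega)$. Then for every $u\colon B^0\to\mathbb{R}$ and every extension $v\colon Q^0\to\mathbb{R}$ of $u$, $$h^2\,L^2_{\Omega\setminus K}(u)\le C_{\Omega,e}\bigl(h\,r\,L^2_{\partial Q}(u)+r^2E_Q(v)\bigr).$$ -/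

import Mathlib

open scoped ContDiff

/-- The planar cross product `a × b`: twice the signed (counterclockwise positive) area of the
triangle spanned by the vectors `a` and `b`. -/
def planeCross (a b : ℂ) : ℝ := a.re * b.im - a.im * b.re

/-- A (not necessarily convex) nondegenerate simple quadrilateral, with its vertices listed
clockwise. A simple quadrilateral has a diagonal that cuts it into two nondegenerate triangles;
the cyclic list of vertices starts at an end of such a diagonal, so that both triangles
`v₀v₁v₂` and `v₀v₂v₃` are clockwise. Conversely these two conditions force the closed broken line
`v₀v₁v₂v₃` to be simple, because `v₁` and `v₃` lie strictly on different sides of `v₀v₂`. -/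
structure Quad where
  v : Fin 4 → ℂ
  clockwise₁ : planeCross (v 1 - v 0) (v 2 - v 0) < 0
  clockwise₂ : planeCross (v 2 - v 0) (v 3 - v 0) < 0

namespace Quad

/-- The closed region bounded by the quadrilateral. -/
def region (p : Quad) : Set ℂ :=
  convexHull ℝ {p.v 0, p.v 1, p.v 2} ∪ convexHull ℝ {p.v 0, p.v 2, p.v 3}

/-- The `i`-th side, as a closed segment. -/
def side (p : Quad) (i : Fin 4) : Set ℂ := segment ℝ (p.v i) (p.v (i + 1))

/-- The diagonals `v₀v₂` and `v₁v₃`, as vectors. -/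
def diag₁ (p : Quad) : ℂ := p.v 2 - p.v 0

def diag₂ (p : Quad) : ℂ := p.v 3 - p.v 1

noncomputable def area (p : Quad) : ℝ := MeasureTheory.volume.real p.region

/-- The angle between the two diagonals (as lines), a number in `[0, π/2]`. -/
noncomputable def diagAngle (p : Quad) : ℝ :=
  min (InnerProductGeometry.angle p.diag₁ p.diag₂)
    (Real.pi - InnerProductGeometry.angle p.diag₁ p.diag₂)

/-- The gradient of a function with vertex values `f`, as a vector of the plane `ℂ = ℝ²`: the
unique vector whose scalar products with the diagonals are the increments of `f` along them
(`gradient_iff`). -/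
noncomputable def gradient (p : Quad) (f : Fin 4 → ℝ) : ℂ :=
  ⟨((f 2 - f 0) * p.diag₂.im - (f 3 - f 1) * p.diag₁.im) / planeCross p.diag₁ p.diag₂,
   ((f 3 - f 1) * p.diag₁.re - (f 2 - f 0) * p.diag₂.re) / planeCross p.diag₁ p.diag₂⟩

theorem planeCross_diag_neg (p : Quad) : planeCross p.diag₁ p.diag₂ < 0 := by
  have h1 := p.clockwise₁
  have h2 := p.clockwise₂
  simp only [planeCross, diag₁, diag₂, Complex.sub_re, Complex.sub_im] at *
  nlinarith

theorem gradient_iff (p : Quad) (f : Fin 4 → ℝ) (g : ℂ) :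
    g = p.gradient f ↔
      inner ℝ g (p.v 2 - p.v 0) = f 2 - f 0 ∧ inner ℝ g (p.v 3 - p.v 1) = f 3 - f 1 := by
  have hD : planeCross p.diag₁ p.diag₂ ≠ 0 := p.planeCross_diag_neg.ne
  change g = p.gradient f ↔ inner ℝ g p.diag₁ = f 2 - f 0 ∧ inner ℝ g p.diag₂ = f 3 - f 1
  simp only [gradient, Complex.ext_iff, eq_div_iff hD]
  simp only [Complex.inner, Complex.mul_re, Complex.conj_re, Complex.conj_im]
  constructor
  · rintro ⟨h1, h2⟩
    constructor <;> refine mul_right_cancel₀ hD ?_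
    · simp only [planeCross] at *
      linear_combination p.diag₁.re * h1 + p.diag₁.im * h2
    · simp only [planeCross] at *
      linear_combination p.diag₂.re * h1 + p.diag₂.im * h2
  · rintro ⟨h1, h2⟩
    simp only [planeCross]
    constructor
    · linear_combination p.diag₂.im * h1 - p.diag₁.im * h2
    · linear_combination p.diag₁.re * h2 - p.diag₂.re * h1

end Quad

/-- A finite quadrilateral lattice, given by its bounded faces. Two distinct faces are disjoint or
meet exactly in one common vertex or in one common edge. The outer face is the complement of the
union of the closed bounded faces, and its boundary is a closed curve without
self-intersections. -/
structure QuadLattice where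
  faces : Finset Quad
  inter_faces : ∀ p ∈ faces, ∀ q ∈ faces, p ≠ q →
    p.region ∩ q.region = ∅ ∨
    (∃ i j, p.v i = q.v j ∧ p.region ∩ q.region = {p.v i}) ∨
    (∃ i j, p.side i = q.side j ∧ p.region ∩ q.region = p.side i)
  simple_boundary : ∃ γ : Circle → ℂ, Continuous γ ∧ Function.Injective γ ∧
    Set.range γ = frontier (⋃ p ∈ faces, p.region)

namespace QuadLattice

/-- The union of the closed bounded faces. -/
def carrier (Q : QuadLattice) : Set ℂ := ⋃ p ∈ Q.faces, p.region

/-- `∂Q`, the boundary of the outer face (which is the complement of `Q.carrier`). -/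
def boundary (Q : QuadLattice) : Set ℂ := frontier Q.carrier

/-- `Q⁰`, the set of vertices. -/
noncomputable def vertices (Q : QuadLattice) : Finset ℂ :=
  Q.faces.biUnion fun p => Finset.univ.image p.v

theorem mem_vertices (Q : QuadLattice) (p : Q.faces) (i : Fin 4) : p.1.v i ∈ Q.vertices :=
  Finset.mem_biUnion.2 ⟨p.1, p.2, Finset.mem_image_of_mem _ (Finset.mem_univ i)⟩

/-- The maximal edge length. -/
noncomputable def maxEdge (Q : QuadLattice) : ℝ :=
  ⨆ s : Q.faces × Fin 4, dist (s.1.1.v s.2) (s.1.1.v (s.2 + 1))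

/-- `h`: twice the maximal edge length. -/
noncomputable def h (Q : QuadLattice) : ℝ := 2 * Q.maxEdge

/-- Conditions (D) and (U): the ratio of the diagonals of each face (in either order) is less
than `c`, the angle between them is greater than `1 / c`, and every disk of radius equal to the
maximal edge length contains less than `c` vertices. -/
def NondegenerateUniform (Q : QuadLattice) (c : ℝ) : Prop :=
  (∀ p ∈ Q.faces, ‖p.diag₁‖ / ‖p.diag₂‖ < c ∧ ‖p.diag₂‖ / ‖p.diag₁‖ < c ∧
    1 / c < p.diagAngle) ∧
  ∀ w : ℂ, (((Q.vertices : Set ℂ) ∩ Metric.closedBall w Q.maxEdge).ncard : ℝ) < c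

/-- The eccentricity of the lattice. -/
noncomputable def eccentricity (Q : QuadLattice) : ℝ := sInf {c : ℝ | Q.NondegenerateUniform c}

/-- The graph on `Q⁰` joining the opposite vertices of each face. It has two connected
components, the graphs `B` and `W` associated to the lattice. -/
def diagGraph (Q : QuadLattice) : SimpleGraph Q.vertices :=
  SimpleGraph.fromRel fun z w => ∃ p ∈ Q.faces, ∃ i, p.v i = z ∧ p.v (i + 2) = w

/-- The energy `E_Q(u) = ∑ |∇_Q u|² · Area`, the sum over all faces. -/
noncomputable def energy (Q : QuadLattice) (u : Q.vertices → ℝ) : ℝ :=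
  ∑ p : Q.faces, ‖p.1.gradient fun i => u ⟨p.1.v i, Q.mem_vertices p i⟩‖ ^ 2 * p.1.area

open Classical in
/-- `L²_K(u)`: the sum of `u(z)²` over `z ∈ K ∩ B⁰`. -/
noncomputable def sqSum (Q : QuadLattice) (B : Q.diagGraph.ConnectedComponent)
    (K : Set ℂ) (u : B.supp → ℝ) : ℝ :=
  ∑ z : B.supp, if (z.1 : ℂ) ∈ K then u z ^ 2 else 0

end QuadLattice

/-- An open plane set has smooth boundary: near each boundary point it is a sublevel set of a
smooth function with nonvanishing differential. -/
def HasSmoothBoundary (Ω : Set ℂ) : Prop :=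
  ∀ p ∈ frontier Ω, ∃ φ : ℂ → ℝ, ContDiff ℝ ∞ φ ∧ φ p = 0 ∧ fderiv ℝ φ p ≠ 0 ∧
    ∀ᶠ z in nhds p, (z ∈ Ω ↔ φ z < 0)

open Set Filter Topology

theorem convex_planeCross_nonpos (d a : ℂ) : Convex ℝ {x : ℂ | planeCross d (x - a) ≤ 0} := by
  intro x hx y hy s t hs ht hst
  simp only [mem_ofPred_eq] at *
  have : planeCross d (s • x + t • y - a) = s * planeCross d (x - a) + t * planeCross d (y - a) := by
    simp [planeCross]
    linear_combination (d.re * a.im - d.im * a.re) * hst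
  rw [this]
  nlinarith

theorem planeCross_sub_comm (a b x : ℂ) : planeCross (a - b) (x - b) = -planeCross (b - a) (x - a) := by
  simp [planeCross]; ring

@[fun_prop]
theorem continuous_planeCross (a b : ℂ) : Continuous fun x : ℂ => planeCross a (x - b) := by
  unfold planeCross
  fun_prop

theorem Convex.add_three_mem {s : Set ℂ} (hs : Convex ℝ s) {a b c : ℂ} (ha : a ∈ s) (hb : b ∈ s)
    (hc : c ∈ s) {α β γ : ℝ} (hα : 0 ≤ α) (hβ : 0 ≤ β) (hγ : 0 ≤ γ) (h : α + β + γ = 1) :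
    α • a + β • b + γ • c ∈ s := by
  have := hs.sum_mem (t := Finset.univ) (w := ![α, β, γ]) (z := ![a, b, c])
    (by intro i _; fin_cases i <;> simpa) (by simpa [Fin.sum_univ_three] using h)
    (by intro i _; fin_cases i <;> simpa)
  simpa [Fin.sum_univ_three] using this

theorem mem_triangle_iff {a b c : ℂ} (h : planeCross (b - a) (c - a) < 0) (x : ℂ) :
    x ∈ convexHull ℝ {a, b, c} ↔ planeCross (b - a) (x - a) ≤ 0 ∧
      planeCross (c - b) (x - b) ≤ 0 ∧ planeCross (a - c) (x - c) ≤ 0 := by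
  constructor
  · intro hx
    have h1 : planeCross (c - b) (a - b) = planeCross (b - a) (c - a) := by
      simp [planeCross]; ring
    have h2 : planeCross (a - c) (b - c) = planeCross (b - a) (c - a) := by
      simp [planeCross]; ring
    refine ⟨convexHull_min ?_ (convex_planeCross_nonpos (b - a) a) hx,
      convexHull_min ?_ (convex_planeCross_nonpos (c - b) b) hx,
      convexHull_min ?_ (convex_planeCross_nonpos (a - c) c) hx⟩
    all_goals
      rintro y (rfl | rfl | rfl)
      all_goals simp only [mem_ofPred_eq]
      all_goals first
        | exact h.le
        | exact h1.trans_le h.le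
        | exact h2.trans_le h.le
        | simp [planeCross, mul_comm]
  · rintro ⟨h1, h2, h3⟩
    set D := planeCross (b - a) (c - a) with hD
    have hsum : planeCross (c - b) (x - b) + planeCross (a - c) (x - c) +
        planeCross (b - a) (x - a) = D := by
      simp [hD, planeCross]; ring
    have key := (convex_convexHull ℝ {a, b, c}).add_three_mem
      (subset_convexHull ℝ _ (by simp : a ∈ ({a, b, c} : Set ℂ)))
      (subset_convexHull ℝ _ (by simp : b ∈ ({a, b, c} : Set ℂ)))
      (subset_convexHull ℝ _ (by simp : c ∈ ({a, b, c} : Set ℂ)))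
      (div_nonneg_of_nonpos h2 h.le) (div_nonneg_of_nonpos h3 h.le)
      (div_nonneg_of_nonpos h1 h.le) (by rw [← add_div, ← add_div, hsum, div_self h.ne])
    convert key
    have hD' : D ≠ 0 := h.ne
    apply Complex.ext <;> simp <;> field_simp <;> simp [hD, planeCross] <;> ring

theorem eq_or_eq_of_segment_eq {a b c d : ℂ} (hab : a ≠ b) (h : segment ℝ a b = segment ℝ c d) :
    a = c ∨ a = d := by
  have hc : c ∈ segment ℝ a b := h ▸ left_mem_segment ℝ c d
  have hd : d ∈ segment ℝ a b := h ▸ right_mem_segment ℝ c d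
  have ha : a ∈ segment ℝ c d := h ▸ left_mem_segment ℝ a b
  rw [segment_eq_image'] at hc hd
  obtain ⟨s, ⟨hs, -⟩, rfl⟩ := hc
  obtain ⟨t, ⟨ht, -⟩, rfl⟩ := hd
  obtain ⟨α, β, hα, hβ, hαβ, ha⟩ := ha
  have h0 : (α * s + β * t) • (b - a) = 0 := by
    have : a + (α * s + β * t) • (b - a) = a := by
      calc a + (α * s + β * t) • (b - a) = (α + β) • a + (α * s + β * t) • (b - a) := by
            rw [hαβ, one_smul]
        _ = α • (a + s • (b - a)) + β • (a + t • (b - a)) := by module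
        _ = a := ha
    simpa using this
  have h1 : α * s + β * t = 0 := (smul_eq_zero.1 h0).resolve_right (sub_ne_zero.2 hab.symm)
  have h2 : α * s = 0 := by nlinarith [mul_nonneg hα hs, mul_nonneg hβ ht]
  rcases mul_eq_zero.1 h2 with h3 | h3
  · right
    rw [h3, zero_smul, zero_add] at ha
    rw [h3, zero_add] at hαβ
    rw [hαβ, one_smul] at ha
    exact ha.symm
  · left
    simp [h3]

namespace Quad

variable (p : Quad)

/-- The side function of a quadrilateral: nonpositive on the inner side of the `i`-th side. -/
noncomputable def sideFun (i : Fin 4) (x : ℂ) : ℝ := planeCross (p.v (i + 1) - p.v i) (x - p.v i)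

noncomputable def diagFun (x : ℂ) : ℝ := planeCross (p.v 2 - p.v 0) (x - p.v 0)

theorem continuous_sideFun (i : Fin 4) : Continuous (p.sideFun i) := continuous_planeCross _ _

theorem continuous_diagFun : Continuous p.diagFun := continuous_planeCross _ _

theorem mem_region_iff (x : ℂ) : x ∈ p.region ↔
    (0 ≤ p.diagFun x ∧ p.sideFun 0 x ≤ 0 ∧ p.sideFun 1 x ≤ 0) ∨
    (p.diagFun x ≤ 0 ∧ p.sideFun 2 x ≤ 0 ∧ p.sideFun 3 x ≤ 0) := by
  rw [region, mem_union, mem_triangle_iff p.clockwise₁, mem_triangle_iff p.clockwise₂,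
    planeCross_sub_comm (p.v 0) (p.v 2), neg_nonpos]
  change (p.sideFun 0 x ≤ 0 ∧ p.sideFun 1 x ≤ 0 ∧ 0 ≤ p.diagFun x) ∨
    (p.diagFun x ≤ 0 ∧ p.sideFun 2 x ≤ 0 ∧ p.sideFun 3 x ≤ 0) ↔ _
  tauto

theorem sideFun_combo (i : Fin 4) (a b : ℂ) {s t : ℝ} (h : s + t = 1) :
    p.sideFun i (s • a + t • b) = s * p.sideFun i a + t * p.sideFun i b := by
  obtain rfl : s = 1 - t := by linarith
  simp [sideFun, planeCross]; ring

theorem diagFun_combo (a b : ℂ) {s t : ℝ} (h : s + t = 1) :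
    p.diagFun (s • a + t • b) = s * p.diagFun a + t * p.diagFun b := by
  obtain rfl : s = 1 - t := by linarith
  simp [diagFun, planeCross]; ring

theorem diagFun_zero : p.diagFun (p.v 0) = 0 := by simp [diagFun, planeCross]
theorem diagFun_two : p.diagFun (p.v 2) = 0 := by simp [diagFun, planeCross, mul_comm]
theorem diagFun_one : 0 < p.diagFun (p.v 1) := by
  have := p.clockwise₁
  simp only [diagFun, planeCross] at *; linarith
theorem diagFun_three : p.diagFun (p.v 3) < 0 := p.clockwise₂

theorem sideFun_self (i : Fin 4) : p.sideFun i (p.v i) = 0 := by simp [sideFun, planeCross]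
theorem sideFun_succ (i : Fin 4) : p.sideFun i (p.v (i + 1)) = 0 := by
  simp [sideFun, planeCross, mul_comm]

theorem sideFun_zero_two : p.sideFun 0 (p.v 2) < 0 := p.clockwise₁
theorem sideFun_one_zero : p.sideFun 1 (p.v 0) < 0 := by
  have := p.clockwise₁
  simp only [sideFun, planeCross, Complex.sub_re, Complex.sub_im, Fin.reduceAdd] at *; linarith
theorem sideFun_two_zero : p.sideFun 2 (p.v 0) < 0 := by
  have := p.clockwise₂
  simp only [sideFun, planeCross, Complex.sub_re, Complex.sub_im, Fin.reduceAdd] at *; linarith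
theorem sideFun_three_two : p.sideFun 3 (p.v 2) < 0 := by
  have := p.clockwise₂
  simp only [sideFun, planeCross, Complex.sub_re, Complex.sub_im] at *
  change (p.v 0 - p.v 3).re * _ - (p.v 0 - p.v 3).im * _ < 0
  simp only [Complex.sub_re, Complex.sub_im]
  linarith

/-- The `i`-th side without its ends. -/
def openSide (i : Fin 4) : Set ℂ := openSegment ℝ (p.v i) (p.v (i + 1))

theorem openSide_subset_side (i : Fin 4) : p.openSide i ⊆ p.side i := openSegment_subset_segment _ _ _

theorem sideFun_eq_zero_of_mem_side {i : Fin 4} {x : ℂ} (h : x ∈ p.side i) : p.sideFun i x = 0 := by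
  obtain ⟨s, t, -, -, hst, rfl⟩ := h
  rw [p.sideFun_combo _ _ _ hst, sideFun_self, sideFun_succ]; simp

/-- Where an open side lies with respect to the other lines of the quadrilateral. -/
theorem openSide_facts {i : Fin 4} {x : ℂ} (h : x ∈ p.openSide i) :
    (i = 0 ∧ 0 < p.diagFun x ∧ p.sideFun 1 x < 0) ∨ (i = 1 ∧ 0 < p.diagFun x ∧ p.sideFun 0 x < 0) ∨
    (i = 2 ∧ p.diagFun x < 0 ∧ p.sideFun 3 x < 0) ∨
    (i = 3 ∧ p.diagFun x < 0 ∧ p.sideFun 2 x < 0) := by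
  obtain ⟨s, t, hs, ht, hst, rfl⟩ := h
  rw [p.sideFun_combo _ _ _ hst, p.sideFun_combo _ _ _ hst, p.sideFun_combo _ _ _ hst,
    p.sideFun_combo _ _ _ hst, p.diagFun_combo _ _ hst]
  have a0 := p.diagFun_zero
  have a1 := p.diagFun_one
  have a2 := p.diagFun_two
  have a3 := p.diagFun_three
  have b0 := p.sideFun_zero_two
  have b1 := p.sideFun_one_zero
  have b2 := p.sideFun_two_zero
  have b3 := p.sideFun_three_two
  have c0 := p.sideFun_self
  have c1 := p.sideFun_succ 0
  have c2 := p.sideFun_succ 1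
  have c3 := p.sideFun_succ 2
  have c4 := p.sideFun_succ 3
  have e4 : (3 + 1 : Fin 4) = 0 := rfl
  simp only [Fin.reduceAdd, zero_add] at c1 c2 c3 c4
  fin_cases i <;> simp [a0, a2, c0, c1, c2, c3, e4]
  · exact ⟨by positivity, by nlinarith⟩
  · exact ⟨by positivity, by nlinarith⟩
  · exact ⟨by nlinarith, by nlinarith⟩
  · exact ⟨by nlinarith, by nlinarith⟩

theorem eventually_mem_region_iff {i : Fin 4} {w : ℂ} (h : w ∈ p.openSide i) :
    ∀ᶠ x in 𝓝 w, (x ∈ p.region ↔ p.sideFun i x ≤ 0) := by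
  have hpos : ∀ f : ℂ → ℝ, Continuous f → 0 < f w → ∀ᶠ x in 𝓝 w, 0 < f x := fun f hf h0 =>
    hf.continuousAt.eventually_const_lt h0
  have hneg : ∀ f : ℂ → ℝ, Continuous f → f w < 0 → ∀ᶠ x in 𝓝 w, f x < 0 := fun f hf h0 =>
    hf.continuousAt.eventually_lt_const h0
  rcases p.openSide_facts h with ⟨rfl, h1, h2⟩ | ⟨rfl, h1, h2⟩ | ⟨rfl, h1, h2⟩ | ⟨rfl, h1, h2⟩
  · filter_upwards [hpos _ p.continuous_diagFun h1, hneg _ (p.continuous_sideFun 1) h2] with x h1 h2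
    rw [mem_region_iff]
    exact ⟨by rintro (h | h) <;> linarith, fun h => .inl ⟨h1.le, h, h2.le⟩⟩
  · filter_upwards [hpos _ p.continuous_diagFun h1, hneg _ (p.continuous_sideFun 0) h2] with x h1 h2
    rw [mem_region_iff]
    exact ⟨by rintro (h | h) <;> linarith, fun h => .inl ⟨h1.le, h2.le, h⟩⟩
  · filter_upwards [hneg _ p.continuous_diagFun h1, hneg _ (p.continuous_sideFun 3) h2] with x h1 h2
    rw [mem_region_iff]
    exact ⟨by rintro (h | h) <;> linarith, fun h => .inr ⟨h1.le, h, h2.le⟩⟩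
  · filter_upwards [hneg _ p.continuous_diagFun h1, hneg _ (p.continuous_sideFun 2) h2] with x h1 h2
    rw [mem_region_iff]
    exact ⟨by rintro (h | h) <;> linarith, fun h => .inr ⟨h1.le, h2.le, h⟩⟩

theorem mem_openSide_of_mem_side {i : Fin 4} {x : ℂ} (h : x ∈ p.side i) (hv : ∀ j, x ≠ p.v j) :
    x ∈ p.openSide i :=
  mem_openSegment_of_ne_left_right (hv i).symm (hv (i + 1)).symm h

/-- Distinct open sides are disjoint. -/
theorem openSide_unique {i j : Fin 4} {x : ℂ} (hi : x ∈ p.openSide i) (hj : x ∈ p.openSide j) :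
    i = j := by
  have ei := p.sideFun_eq_zero_of_mem_side (p.openSide_subset_side i hi)
  have ej := p.sideFun_eq_zero_of_mem_side (p.openSide_subset_side j hj)
  rcases p.openSide_facts hi with ⟨rfl, h1, h2⟩ | ⟨rfl, h1, h2⟩ | ⟨rfl, h1, h2⟩ | ⟨rfl, h1, h2⟩ <;>
  rcases p.openSide_facts hj with ⟨rfl, h3, h4⟩ | ⟨rfl, h3, h4⟩ | ⟨rfl, h3, h4⟩ | ⟨rfl, h3, h4⟩ <;>
  first
    | rfl
    | (exfalso; linarith)

theorem v_ne_succ (i : Fin 4) : p.v i ≠ p.v (i + 1) := by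
  have a0 := p.diagFun_zero
  have a1 := p.diagFun_one
  have a2 := p.diagFun_two
  have a3 := p.diagFun_three
  have e4 : (3 + 1 : Fin 4) = 0 := rfl
  intro h
  fin_cases i
  all_goals simp [e4] at h
  all_goals (first | rw [h] at a0 | rw [h] at a2 | rw [← h] at a0 | rw [← h] at a2); linarith

/-- The points of the sides are not interior. -/
theorem not_mem_interior_region {i : Fin 4} {w : ℂ} (h : w ∈ p.openSide i) :
    w ∉ interior p.region := by
  intro hw
  have h1 : ∀ᶠ x in 𝓝 w, p.sideFun i x ≤ 0 := by
    filter_upwards [p.eventually_mem_region_iff h, mem_interior_iff_mem_nhds.1 hw] with x hx hx'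
    exact hx.1 hx'
  have hd : p.v (i + 1) - p.v i ≠ 0 := sub_ne_zero.2 (p.v_ne_succ i).symm
  set d := p.v (i + 1) - p.v i
  have ht : Tendsto (fun t : ℝ => w + t • (Complex.I * d)) (𝓝[>] 0) (𝓝 w) := by
    have : Continuous (fun t : ℝ => w + t • (Complex.I * d)) := by fun_prop
    simpa using (this.tendsto 0).mono_left nhdsWithin_le_nhds
  have h2 := ht.eventually h1
  obtain ⟨t, ht1, ht2⟩ := (h2.and self_mem_nhdsWithin).exists
  have h0 := p.sideFun_eq_zero_of_mem_side (p.openSide_subset_side i h)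
  have : p.sideFun i (w + t • (Complex.I * d)) = p.sideFun i w + t * (d.re ^ 2 + d.im ^ 2) := by
    simp [sideFun, planeCross, d]; ring
  rw [this, h0, zero_add] at ht1
  have hn : 0 < d.re ^ 2 + d.im ^ 2 := by
    have := Complex.normSq_pos.2 hd
    rw [Complex.normSq_apply] at this
    nlinarith
  have := mul_pos (show (0 : ℝ) < t from ht2) hn
  linarith

theorem isCompact_region : IsCompact p.region :=
  ((Set.toFinite _).isCompact_convexHull ℝ).union ((Set.toFinite _).isCompact_convexHull ℝ)

theorem v_mem_region (i : Fin 4) : p.v i ∈ p.region := by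
  fin_cases i
  · exact .inl (subset_convexHull ℝ _ (by simp))
  · exact .inl (subset_convexHull ℝ _ (by simp))
  · exact .inl (subset_convexHull ℝ _ (by simp))
  · exact .inr (subset_convexHull ℝ _ (by simp))

/-- Points of a closed quadrilateral that are on no side are interior. -/
theorem exists_mem_side {x : ℂ} (hx : x ∈ p.region) (hi : x ∉ interior p.region) :
    ∃ i, x ∈ p.side i := by
  have hside : ∀ {a b c : ℂ}, planeCross (b - a) (c - a) < 0 → x ∈ convexHull ℝ {a, b, c} →
      (planeCross (b - a) (x - a) = 0 → x ∈ segment ℝ a b) ∧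
      (planeCross (c - b) (x - b) = 0 → x ∈ segment ℝ b c) ∧
      (planeCross (a - c) (x - c) = 0 → x ∈ segment ℝ c a) := by
    intro a b c h hx
    obtain ⟨h1, h2, h3⟩ := (mem_triangle_iff h x).1 hx
    set D := planeCross (b - a) (c - a) with hD
    have hD' : D ≠ 0 := h.ne
    have hsum : planeCross (c - b) (x - b) + planeCross (a - c) (x - c) +
        planeCross (b - a) (x - a) = D := by
      simp [hD, planeCross]; ring
    have hx' : x = (planeCross (c - b) (x - b) / D) • a + (planeCross (a - c) (x - c) / D) • b +
        (planeCross (b - a) (x - a) / D) • c := by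
      apply Complex.ext <;> simp <;> field_simp <;> simp [hD, planeCross] <;> ring
    have p1 := div_nonneg_of_nonpos h1 h.le
    have p2 := div_nonneg_of_nonpos h2 h.le
    have p3 := div_nonneg_of_nonpos h3 h.le
    have hs : planeCross (c - b) (x - b) / D + planeCross (a - c) (x - c) / D +
        planeCross (b - a) (x - a) / D = 1 := by
      rw [← add_div, ← add_div, hsum, div_self h.ne]
    generalize planeCross (c - b) (x - b) = A at *
    generalize planeCross (a - c) (x - c) = B at *
    generalize planeCross (b - a) (x - a) = C at *
    refine ⟨?_, ?_, ?_⟩ <;> rintro rfl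
    · exact ⟨_, _, p2, p3, by simpa using hs, by simpa using hx'.symm⟩
    · exact ⟨_, _, p3, p1, by simpa using hs, by simpa using hx'.symm⟩
    · refine ⟨_, _, p1, p2, by linarith [zero_div D], ?_⟩
      simp only [zero_div, zero_smul, add_zero] at hx'
      rw [add_comm]; exact hx'.symm
  by_contra! hne
  apply hi
  rw [mem_interior_iff_mem_nhds]
  have hneg : ∀ f : ℂ → ℝ, Continuous f → f x < 0 → ∀ᶠ y in 𝓝 x, f y < 0 := fun f hf h0 =>
    hf.continuousAt.eventually_lt_const h0
  have hpos : ∀ f : ℂ → ℝ, Continuous f → 0 < f x → ∀ᶠ y in 𝓝 x, 0 < f y := fun f hf h0 =>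
    hf.continuousAt.eventually_const_lt h0
  have t1 : 0 ≤ p.diagFun x ∧ p.sideFun 0 x ≤ 0 ∧ p.sideFun 1 x ≤ 0 →
      p.sideFun 0 x < 0 ∧ p.sideFun 1 x < 0 := by
    intro h
    have hx : x ∈ convexHull ℝ {p.v 0, p.v 1, p.v 2} := by
      rw [mem_triangle_iff p.clockwise₁, planeCross_sub_comm (p.v 0) (p.v 2), neg_nonpos]
      exact ⟨h.2.1, h.2.2, h.1⟩
    obtain ⟨s1, s2, -⟩ := hside p.clockwise₁ hx
    exact ⟨lt_of_le_of_ne h.2.1 fun h => hne 0 (s1 h), lt_of_le_of_ne h.2.2 fun h => hne 1 (s2 h)⟩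
  have t2 : p.diagFun x ≤ 0 ∧ p.sideFun 2 x ≤ 0 ∧ p.sideFun 3 x ≤ 0 →
      p.sideFun 2 x < 0 ∧ p.sideFun 3 x < 0 := by
    intro h
    have hx : x ∈ convexHull ℝ {p.v 0, p.v 2, p.v 3} := by
      rw [mem_triangle_iff p.clockwise₂]
      exact h
    obtain ⟨-, s1, s2⟩ := hside p.clockwise₂ hx
    exact ⟨lt_of_le_of_ne h.2.1 fun h => hne 2 (s1 h), lt_of_le_of_ne h.2.2 fun h => hne 3 (s2 h)⟩
  have hx' := (p.mem_region_iff x).1 hx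
  rcases lt_trichotomy (p.diagFun x) 0 with hd | hd | hd
  · obtain ⟨h1, h2⟩ := t2 (hx'.resolve_left fun h => absurd h.1 (not_le.2 hd))
    filter_upwards [hneg _ p.continuous_diagFun hd, hneg _ (p.continuous_sideFun 2) h1,
      hneg _ (p.continuous_sideFun 3) h2] with y a b c
    exact (p.mem_region_iff y).2 (.inr ⟨a.le, b.le, c.le⟩)
  · -- an interior point of the diagonal
    have hboth : p.sideFun 0 x < 0 ∧ p.sideFun 1 x < 0 ∧ p.sideFun 2 x < 0 ∧ p.sideFun 3 x < 0 := by
      have hseg : x ∈ segment ℝ (p.v 2) (p.v 0) := by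
        rcases hx with hx | hx
        · refine (hside p.clockwise₁ hx).2.2 ?_
          rw [planeCross_sub_comm]
          change -p.diagFun x = 0
          rw [hd, neg_zero]
        · rw [segment_symm]
          exact (hside p.clockwise₂ hx).1 hd
      have n1 : x ∈ convexHull ℝ {p.v 0, p.v 1, p.v 2} := by
        refine (convex_convexHull ℝ _).segment_subset (subset_convexHull ℝ _ (by simp))
          (subset_convexHull ℝ _ (by simp)) hseg
      have n2 : x ∈ convexHull ℝ {p.v 0, p.v 2, p.v 3} := by
        refine (convex_convexHull ℝ _).segment_subset (subset_convexHull ℝ _ (by simp))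
          (subset_convexHull ℝ _ (by simp)) hseg
      rw [mem_triangle_iff p.clockwise₁] at n1
      rw [mem_triangle_iff p.clockwise₂] at n2
      obtain ⟨a, b⟩ := t1 ⟨hd.ge, n1.1, n1.2.1⟩
      obtain ⟨c, d⟩ := t2 n2
      exact ⟨a, b, c, d⟩
    obtain ⟨h1, h2, h3, h4⟩ := hboth
    filter_upwards [hneg _ (p.continuous_sideFun 0) h1, hneg _ (p.continuous_sideFun 1) h2,
      hneg _ (p.continuous_sideFun 2) h3, hneg _ (p.continuous_sideFun 3) h4] with y a b c d
    refine (p.mem_region_iff y).2 ?_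
    rcases le_total 0 (p.diagFun y) with h | h
    · exact .inl ⟨h, a.le, b.le⟩
    · exact .inr ⟨h, c.le, d.le⟩
  · obtain ⟨h1, h2⟩ := t1 (hx'.resolve_right fun h => absurd h.1 (not_le.2 hd))
    filter_upwards [hpos _ p.continuous_diagFun hd, hneg _ (p.continuous_sideFun 0) h1,
      hneg _ (p.continuous_sideFun 1) h2] with y a b c
    exact (p.mem_region_iff y).2 (.inl ⟨a.le, b.le, c.le⟩)

theorem ends_of_side_eq {p q : Quad} {i j : Fin 4} (h : p.side i = q.side j) :
    (p.v i = q.v j ∧ p.v (i + 1) = q.v (j + 1)) ∨ (p.v i = q.v (j + 1) ∧ p.v (i + 1) = q.v j) := by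
  have hp := p.v_ne_succ i
  have h1 := eq_or_eq_of_segment_eq hp h
  have h2 := eq_or_eq_of_segment_eq hp.symm ((segment_symm ℝ _ _).trans h)
  rcases h1 with h1 | h1 <;> rcases h2 with h2 | h2
  · exact absurd (h1.trans h2.symm) hp
  · exact .inl ⟨h1, h2⟩
  · exact .inr ⟨h1, h2⟩
  · exact absurd (h1.trans h2.symm) hp

/-- Two quadrilaterals meeting in a common side lie on different sides of it. -/
theorem openSide_subset_interior_union {p q : Quad} {i j : Fin 4} (h : p.side i = q.side j)
    (hpq : p.region ∩ q.region = p.side i) {w : ℂ} (hw : w ∈ p.openSide i) :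
    w ∈ interior (p.region ∪ q.region) := by
  have hends := ends_of_side_eq h
  have hwq : w ∈ q.openSide j := by
    rcases hends with ⟨h1, h2⟩ | ⟨h1, h2⟩
    · rwa [openSide, ← h1, ← h2]
    · rwa [openSide, ← h1, ← h2, openSegment_symm]
  have e1 := p.eventually_mem_region_iff hw
  have e2 := q.eventually_mem_region_iff hwq
  rw [mem_interior_iff_mem_nhds]
  rcases hends with ⟨h1, h2⟩ | ⟨h1, h2⟩
  · exfalso
    have hs : p.sideFun i = q.sideFun j := by funext x; simp [sideFun, h1, h2]
    have hd : p.v (i + 1) - p.v i ≠ 0 := sub_ne_zero.2 (p.v_ne_succ i).symm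
    set d := p.v (i + 1) - p.v i with hdd
    have ht : Tendsto (fun t : ℝ => w + t • (Complex.I * d)) (𝓝[<] 0) (𝓝 w) := by
      have : Continuous (fun t : ℝ => w + t • (Complex.I * d)) := by fun_prop
      simpa using (this.tendsto 0).mono_left nhdsWithin_le_nhds
    obtain ⟨t, ⟨ht1, ht2⟩, ht0⟩ := ((ht.eventually (e1.and e2)).and self_mem_nhdsWithin).exists
    have h0 := p.sideFun_eq_zero_of_mem_side (p.openSide_subset_side i hw)
    have hval : p.sideFun i (w + t • (Complex.I * d)) =
        p.sideFun i w + t * (d.re ^ 2 + d.im ^ 2) := by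
      simp [sideFun, planeCross, d]; ring
    have hn : 0 < d.re ^ 2 + d.im ^ 2 := by
      have := Complex.normSq_pos.2 hd
      rw [Complex.normSq_apply] at this
      nlinarith
    have hneg : p.sideFun i (w + t • (Complex.I * d)) < 0 := by
      rw [hval, h0, zero_add]
      exact mul_neg_of_neg_of_pos ht0 hn
    have hmem : w + t • (Complex.I * d) ∈ p.region ∩ q.region :=
      ⟨ht1.2 hneg.le, ht2.2 (hs ▸ hneg.le)⟩
    rw [hpq] at hmem
    exact hneg.ne (p.sideFun_eq_zero_of_mem_side hmem)
  · filter_upwards [e1, e2] with x hx1 hx2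
    have hs : q.sideFun j x = -p.sideFun i x := by
      rw [sideFun, sideFun, h1, h2, planeCross_sub_comm (q.v j), neg_neg]
    rcases le_total (p.sideFun i x) 0 with h | h
    · exact .inl (hx1.2 h)
    · exact .inr (hx2.2 (by linarith))

end Quad

theorem Quad.region_subset_of_convex (p : Quad) {s : Set ℂ} (hs : Convex ℝ s)
    (h : ∀ i, p.v i ∈ s) : p.region ⊆ s := by
  refine union_subset (convexHull_min ?_ hs) (convexHull_min ?_ hs) <;>
  · rintro x (rfl | rfl | rfl) <;> exact h _

theorem Quad.dist_vertices_le (p : Quad) {m : ℝ} (h : ∀ i, dist (p.v i) (p.v (i + 1)) ≤ m)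
    (i j : Fin 4) : dist (p.v i) (p.v j) ≤ 2 * m := by
  have h0 := h 0
  have h1 := h 1
  have h2 := h 2
  have h3 : dist (p.v 3) (p.v 0) ≤ m := h 3
  simp only [Fin.reduceAdd, zero_add] at h0 h1 h2
  have t1 := dist_triangle (p.v 0) (p.v 1) (p.v 2)
  have t2 := dist_triangle (p.v 1) (p.v 2) (p.v 3)
  have := dist_nonneg (x := p.v 0) (y := p.v 1)
  fin_cases i <;> fin_cases j <;> simp <;>
    first
      | linarith
      | (rw [dist_comm]; linarith)

theorem Quad.dist_le_of_mem_region (p : Quad) {m : ℝ} (h : ∀ i, dist (p.v i) (p.v (i + 1)) ≤ m)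
    (i : Fin 4) {x : ℂ} (hx : x ∈ p.region) : dist x (p.v i) ≤ 2 * m :=
  p.region_subset_of_convex (convex_closedBall (p.v i) (2 * m))
    (fun j => p.dist_vertices_le h j i) hx

theorem volume_real_convexHull_triangle_ge (a b c : ℂ) :
    |planeCross (b - a) (c - a)| / 4 ≤ MeasureTheory.volume.real (convexHull ℝ {a, b, c}) := by
  let f : ℂ →ₗ[ℝ] ℂ :=
    { toFun := fun w => w.re • (b - a) + w.im • (c - a)
      map_add' := by intro x y; simp; ring
      map_smul' := by intro t x; simp; ring }
  have hdet : LinearMap.det f = planeCross (b - a) (c - a) := by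
    rw [← LinearMap.det_toMatrix Complex.basisOneI, Matrix.det_fin_two]
    simp [LinearMap.toMatrix_apply, f, planeCross]
    ring
  set S : Set ℂ := Icc (0 : ℝ) (1 / 2) ×ℂ Icc (0 : ℝ) (1 / 2)
  have hS : MeasureTheory.volume S = ENNReal.ofReal (1 / 4) := by
    have : S = Complex.measurableEquivRealProd ⁻¹' (Icc (0 : ℝ) (1 / 2) ×ˢ Icc (0 : ℝ) (1 / 2)) := by
      ext x; simp [S, Complex.mem_reProdIm]; tauto
    rw [this, Complex.volume_preserving_equiv_real_prod.measure_preimage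
      (measurableSet_Icc.prod measurableSet_Icc).nullMeasurableSet,
      MeasureTheory.Measure.volume_eq_prod, MeasureTheory.Measure.prod_prod, Real.volume_Icc,
      ← ENNReal.ofReal_mul (by norm_num)]
    norm_num
  have hfS : (fun x => a + x) '' (f '' S) ⊆ convexHull ℝ {a, b, c} := by
    rintro _ ⟨_, ⟨w, hw, rfl⟩, rfl⟩
    obtain ⟨⟨h1, h2⟩, h3, h4⟩ := Complex.mem_reProdIm.1 hw
    have := (convex_convexHull ℝ {a, b, c}).add_three_mem
      (subset_convexHull ℝ _ (by simp : a ∈ ({a, b, c} : Set ℂ)))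
      (subset_convexHull ℝ _ (by simp : b ∈ ({a, b, c} : Set ℂ)))
      (subset_convexHull ℝ _ (by simp : c ∈ ({a, b, c} : Set ℂ)))
      (show 0 ≤ 1 - w.re - w.im by linarith) h1 h3 (by ring)
    convert this using 1
    change a + (w.re • (b - a) + w.im • (c - a)) = _
    module
  have hfin : MeasureTheory.volume (convexHull ℝ {a, b, c}) ≠ ⊤ :=
    ((Set.toFinite {a, b, c}).isCompact_convexHull ℝ).measure_lt_top.ne
  have := MeasureTheory.measureReal_mono hfS hfin
  refine le_trans (le_of_eq ?_) this
  rw [MeasureTheory.measureReal_def, image_add_left, MeasureTheory.measure_preimage_add,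
    MeasureTheory.Measure.addHaar_image_linearMap, hdet, hS, ← ENNReal.ofReal_mul (abs_nonneg _),
    ENNReal.toReal_ofReal (by positivity)]
  ring

theorem Quad.area_ge (p : Quad) : |planeCross p.diag₁ p.diag₂| / 8 ≤ p.area := by
  have hfin : MeasureTheory.volume p.region ≠ ⊤ := p.isCompact_region.measure_lt_top.ne
  have h1 := (volume_real_convexHull_triangle_ge (p.v 0) (p.v 1) (p.v 2)).trans
    (MeasureTheory.measureReal_mono (subset_union_left : _ ⊆ p.region) hfin)
  change _ ≤ p.area at h1
  have h2 := (volume_real_convexHull_triangle_ge (p.v 0) (p.v 2) (p.v 3)).trans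
    (MeasureTheory.measureReal_mono (subset_union_right : _ ⊆ p.region) hfin)
  change _ ≤ p.area at h2
  have h3 : planeCross p.diag₁ p.diag₂ = planeCross (p.v 1 - p.v 0) (p.v 2 - p.v 0) +
      planeCross (p.v 2 - p.v 0) (p.v 3 - p.v 0) := by
    simp [planeCross, diag₁, diag₂]; ring
  rw [h3]
  have := abs_add_le (planeCross (p.v 1 - p.v 0) (p.v 2 - p.v 0))
    (planeCross (p.v 2 - p.v 0) (p.v 3 - p.v 0))
  linarith

theorem sin_angle_mul_norm (a b : ℂ) :
    Real.sin (InnerProductGeometry.angle a b) * (‖a‖ * ‖b‖) = |planeCross a b| := by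
  rw [InnerProductGeometry.sin_angle_mul_norm_mul_norm, ← Real.sqrt_sq_eq_abs]
  congr 1
  rw [real_inner_self_eq_norm_sq, real_inner_self_eq_norm_sq, ← Complex.normSq_eq_norm_sq,
    ← Complex.normSq_eq_norm_sq, Complex.normSq_apply, Complex.normSq_apply]
  simp [Complex.inner, planeCross]
  ring

theorem Quad.sin_angle_ge (p : Quad) {c : ℝ} (hc : 0 < c) (h : 1 / c < p.diagAngle) :
    2 / (Real.pi * c) ≤ Real.sin (InnerProductGeometry.angle p.diag₁ p.diag₂) := by
  have hsin : Real.sin p.diagAngle = Real.sin (InnerProductGeometry.angle p.diag₁ p.diag₂) := by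
    unfold diagAngle
    rcases min_choice (InnerProductGeometry.angle p.diag₁ p.diag₂)
      (Real.pi - InnerProductGeometry.angle p.diag₁ p.diag₂) with h | h <;> rw [h]
    rw [Real.sin_pi_sub]
  have h0 : 0 < p.diagAngle := (one_div_pos.2 hc).trans h
  have h1 : p.diagAngle ≤ Real.pi / 2 := by
    have := min_le_left (InnerProductGeometry.angle p.diag₁ p.diag₂)
      (Real.pi - InnerProductGeometry.angle p.diag₁ p.diag₂)
    have := min_le_right (InnerProductGeometry.angle p.diag₁ p.diag₂)
      (Real.pi - InnerProductGeometry.angle p.diag₁ p.diag₂)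
    unfold diagAngle
    linarith
  rw [← hsin]
  refine le_trans ?_ (Real.mul_le_sin h0.le h1)
  calc 2 / (Real.pi * c) = 2 / Real.pi * (1 / c) := by field_simp
    _ ≤ _ := by gcongr

/-- The increments along the diagonals are controlled by the energy of the face. -/
theorem Quad.sq_add_sq_le (p : Quad) {c : ℝ} (hc : 0 < c) (h1 : ‖p.diag₁‖ / ‖p.diag₂‖ < c)
    (h2 : ‖p.diag₂‖ / ‖p.diag₁‖ < c) (h : 1 / c < p.diagAngle) (f : Fin 4 → ℝ) :
    (f 2 - f 0) ^ 2 + (f 3 - f 1) ^ 2 ≤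
      8 * Real.pi * c ^ 2 * (‖p.gradient f‖ ^ 2 * p.area) := by
  obtain ⟨g1, g2⟩ := (p.gradient_iff f (p.gradient f)).1 rfl
  change inner ℝ (p.gradient f) p.diag₁ = _ at g1
  change inner ℝ (p.gradient f) p.diag₂ = _ at g2
  have i1 := abs_real_inner_le_norm (p.gradient f) p.diag₁
  have i2 := abs_real_inner_le_norm (p.gradient f) p.diag₂
  rw [g1] at i1
  rw [g2] at i2
  have hcr := p.planeCross_diag_neg
  have hd1 : 0 < ‖p.diag₁‖ := norm_pos_iff.2 fun h0 => by
    rw [h0] at hcr; simp [planeCross] at hcr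
  have hd2 : 0 < ‖p.diag₂‖ := norm_pos_iff.2 fun h0 => by
    rw [h0] at hcr; simp [planeCross] at hcr
  rw [div_lt_iff₀ hd2] at h1
  rw [div_lt_iff₀ hd1] at h2
  have hs := p.sin_angle_ge hc h
  have ha := p.area_ge
  rw [← sin_angle_mul_norm] at ha
  set g := ‖p.gradient f‖
  set x := ‖p.diag₁‖
  set y := ‖p.diag₂‖
  have hxy : 2 / (Real.pi * c) * (x * y) ≤ 8 * p.area := by
    have := mul_le_mul_of_nonneg_right hs (mul_pos hd1 hd2).le
    linarith
  have hxy' : x * y ≤ 4 * Real.pi * c * p.area := by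
    have hpc : 0 < Real.pi * c := by positivity
    rw [div_mul_eq_mul_div, div_le_iff₀ hpc] at hxy
    linarith
  have e1 : (f 2 - f 0) ^ 2 ≤ g ^ 2 * x ^ 2 := by
    rw [← sq_abs (f 2 - f 0), ← mul_pow]; gcongr
  have e2 : (f 3 - f 1) ^ 2 ≤ g ^ 2 * y ^ 2 := by
    rw [← sq_abs (f 3 - f 1), ← mul_pow]; gcongr
  have e3 : x ^ 2 + y ^ 2 ≤ 2 * c * (x * y) := by nlinarith
  calc _ ≤ g ^ 2 * (x ^ 2 + y ^ 2) := by linarith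
    _ ≤ g ^ 2 * (2 * c * (4 * Real.pi * c * p.area)) := by
        gcongr
        exact e3.trans (by gcongr)
    _ = _ := by ring

namespace QuadLattice

variable (Q : QuadLattice)

theorem dist_le_maxEdge {p : Quad} (hp : p ∈ Q.faces) (i : Fin 4) :
    dist (p.v i) (p.v (i + 1)) ≤ Q.maxEdge :=
  le_ciSup (f := fun s : Q.faces × Fin 4 => dist (s.1.1.v s.2) (s.1.1.v (s.2 + 1)))
    (Set.finite_range _).bddAbove (⟨p, hp⟩, i)

theorem maxEdge_pos {p : Quad} (hp : p ∈ Q.faces) : 0 < Q.maxEdge :=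
  (dist_pos.2 (p.v_ne_succ 0)).trans_le (Q.dist_le_maxEdge hp 0)

theorem dist_le_h {p : Quad} (hp : p ∈ Q.faces) (i : Fin 4) {x : ℂ} (hx : x ∈ p.region) :
    dist x (p.v i) ≤ Q.h :=
  p.dist_le_of_mem_region (Q.dist_le_maxEdge hp) i hx

theorem region_subset_carrier {p : Quad} (hp : p ∈ Q.faces) : p.region ⊆ Q.carrier :=
  subset_biUnion_of_mem (u := fun p : Quad => p.region) hp

theorem isCompact_carrier : IsCompact Q.carrier :=
  Q.faces.finite_toSet.isCompact_biUnion fun p _ => p.isCompact_region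

theorem v_mem_vertices {p : Quad} (hp : p ∈ Q.faces) (i : Fin 4) : p.v i ∈ Q.vertices :=
  Q.mem_vertices ⟨p, hp⟩ i

theorem mem_vertices_iff {z : ℂ} : z ∈ Q.vertices ↔ ∃ p ∈ Q.faces, ∃ i, p.v i = z := by
  simp [vertices]

/-- Two faces with a common point that is not a vertex have a common side through it. -/
theorem exists_common_side {p q : Quad} (hp : p ∈ Q.faces) (hq : q ∈ Q.faces) (hpq : p ≠ q)
    {y : ℂ} (hyp : y ∈ p.region) (hyq : y ∈ q.region) (hy : y ∉ Q.vertices) :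
    ∃ i j, p.side i = q.side j ∧ p.region ∩ q.region = p.side i ∧ y ∈ p.openSide i := by
  have hmem : y ∈ p.region ∩ q.region := ⟨hyp, hyq⟩
  rcases Q.inter_faces p hp q hq hpq with h | ⟨i, j, -, h⟩ | ⟨i, j, hij, h⟩
  · simp [h] at hmem
  · rw [h, mem_singleton_iff] at hmem
    exact absurd (hmem ▸ Q.v_mem_vertices hp i) hy
  · exact ⟨i, j, hij, h, p.mem_openSide_of_mem_side (h ▸ hmem)
      fun k hk => hy (hk ▸ Q.v_mem_vertices hp k)⟩

/-- Near each point, the lattice consists of the faces containing this point. -/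
theorem eventually_mem_face (y : ℂ) :
    ∀ᶠ x in 𝓝 y, ∀ p ∈ Q.faces, x ∈ p.region → y ∈ p.region := by
  rw [Finset.eventually_all]
  intro p _
  by_cases hy : y ∈ p.region
  · exact Eventually.of_forall fun _ _ => hy
  · filter_upwards [p.isCompact_region.isClosed.isOpen_compl.mem_nhds hy] with x hx hx'
    exact absurd hx' hx

theorem mem_carrier_iff {x : ℂ} : x ∈ Q.carrier ↔ ∃ p ∈ Q.faces, x ∈ p.region := by
  simp [carrier]

/-- The ends of a side meeting `∂Q` in a point that is not a vertex belong to `∂Q`. -/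
theorem ends_mem_boundary {p : Quad} (hp : p ∈ Q.faces) {i : Fin 4} {y : ℂ}
    (hyi : y ∈ p.openSide i) (hyb : y ∈ Q.boundary) {a : ℂ}
    (ha : a = p.v i ∨ a = p.v (i + 1)) : a ∈ Q.boundary := by
  have hcl : IsClosed Q.carrier := Q.isCompact_carrier.isClosed
  have hlone : ∀ q ∈ Q.faces, ∀ j, p.side i = q.side j → p.region ∩ q.region ≠ p.side i := by
    intro q hq j hij h
    refine hyb.2 (interior_mono ?_ (Quad.openSide_subset_interior_union hij h hyi))
    exact union_subset (Q.region_subset_carrier hp) (Q.region_subset_carrier hq)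
  have hacl : a ∈ closure (p.openSide i) := by
    rw [Quad.openSide, closure_openSegment]
    rcases ha with rfl | rfl
    · exact left_mem_segment _ _ _
    · exact right_mem_segment _ _ _
  have hav : a ∈ Q.vertices := by rcases ha with rfl | rfl <;> exact Q.v_mem_vertices hp _
  have haopen : a ∉ p.openSide i := by
    rcases ha with rfl | rfl
    · rw [Quad.openSide, left_mem_openSegment_iff]; exact p.v_ne_succ i
    · rw [Quad.openSide, right_mem_openSegment_iff]; exact p.v_ne_succ i
  have hac : a ∈ Q.carrier := by
    rcases ha with rfl | rfl <;> exact Q.region_subset_carrier hp (p.v_mem_region _)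
  by_contra hab
  have hai : a ∈ interior Q.carrier := by
    by_contra h
    exact hab ⟨subset_closure hac, h⟩
  have hU : IsOpen (interior Q.carrier ∩ ((Q.vertices.erase a : Finset ℂ) : Set ℂ)ᶜ) :=
    isOpen_interior.inter (Finset.finite_toSet _).isClosed.isOpen_compl
  obtain ⟨w, ⟨hwi, hwv⟩, hwo⟩ := mem_closure_iff.1 hacl _ hU ⟨hai, by simp⟩
  have hwv' : w ∉ Q.vertices := fun h => hwv (by
    simp only [Finset.coe_erase, Set.mem_sdiff, Finset.mem_coe, mem_singleton_iff]
    exact ⟨h, fun h' => haopen (h' ▸ hwo)⟩)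
  obtain ⟨q, hq, hqp, hwq⟩ : ∃ q ∈ Q.faces, q ≠ p ∧ w ∈ q.region := by
    by_contra! hne
    refine p.not_mem_interior_region hwo (mem_interior_iff_mem_nhds.2 ?_)
    filter_upwards [Q.eventually_mem_face w, mem_interior_iff_mem_nhds.1 hwi] with x hx hxc
    obtain ⟨q, hq, hxq⟩ := Q.mem_carrier_iff.1 hxc
    by_cases h : q = p
    · exact h ▸ hxq
    · exact absurd (hx q hq hxq) (hne q hq h)
  have hwp : w ∈ p.region := by
    have := (p.eventually_mem_region_iff hwo).self_of_nhds
    exact this.2 (p.sideFun_eq_zero_of_mem_side (p.openSide_subset_side i hwo)).le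
  obtain ⟨k, j, hkj, hint, hwk⟩ := Q.exists_common_side hp hq hqp.symm hwp hwq hwv'
  obtain rfl := p.openSide_unique hwo hwk
  exact hlone q hq j hkj hint

end QuadLattice

/-- The relation of being opposite vertices of a quadrilateral from the set. -/
def IsOppositePair (S : Finset Quad) (z w : ℂ) : Prop := ∃ p ∈ S, ∃ i, p.v i = z ∧ p.v (i + 2) = w

theorem IsOppositePair.symm {S : Finset Quad} {z w : ℂ} (h : IsOppositePair S z w) : IsOppositePair S w z := by
  obtain ⟨p, hp, i, h1, h2⟩ := h
  refine ⟨p, hp, i + 2, h2, ?_⟩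
  rw [← h1, add_assoc]
  simp

def oppositeGraph (S : Finset Quad) : SimpleGraph ℂ := SimpleGraph.fromRel (IsOppositePair S)

theorem Quad.reachable_add_two {S : Finset Quad} {p : Quad} (hp : p ∈ S) (i : Fin 4) :
    (oppositeGraph S).Reachable (p.v i) (p.v (i + 2)) := by
  by_cases h : p.v i = p.v (i + 2)
  · rw [← h]
  · exact SimpleGraph.Adj.reachable ⟨h, .inl ⟨p, hp, i, rfl, rfl⟩⟩

/-- The variation of a function along the diagonals of a quadrilateral, each counted twice. -/
noncomputable def Quad.variation (p : Quad) (f : ℂ → ℝ) : ℝ :=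
  ∑ i, |f (p.v i) - f (p.v (i + 2))|

theorem abs_sub_le_sum_edges {G : SimpleGraph ℂ} (f : ℂ → ℝ) {x y : ℂ} (w : G.Walk x y) :
    |f x - f y| ≤
      (w.edges.map (Sym2.lift ⟨fun a b => |f a - f b|, fun _ _ => abs_sub_comm _ _⟩)).sum := by
  induction w with
  | nil => simp
  | cons h w ih =>
    simp only [SimpleGraph.Walk.edges_cons, List.map_cons, List.sum_cons, Sym2.lift_mk]
    exact (abs_sub_le _ _ _).trans (by gcongr)

open Classical in
theorem abs_sub_le_sum_variation {S : Finset Quad} (f : ℂ → ℝ) {x y : ℂ}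
    (h : (oppositeGraph S).Reachable x y) : |f x - f y| ≤ ∑ p ∈ S, p.variation f := by
  obtain ⟨w⟩ := h
  set d : Sym2 ℂ → ℝ := Sym2.lift ⟨fun a b => |f a - f b|, fun _ _ => abs_sub_comm _ _⟩
  have hd : ∀ e, 0 ≤ d e := fun e => by
    induction e with
    | _ a b => exact abs_nonneg _
  set P := w.toPath
  refine (abs_sub_le_sum_edges f P.1).trans ?_
  rw [← List.sum_toFinset _ P.2.isTrail.edges_nodup]
  have hsub : P.1.edges.toFinset ⊆
      (S ×ˢ (Finset.univ : Finset (Fin 4))).image fun a => s(a.1.v a.2, a.1.v (a.2 + 2)) := by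
    intro e he
    have he' := P.1.edges_subset_edgeSet (List.mem_toFinset.1 he)
    induction e with
    | _ a b =>
      obtain ⟨-, h⟩ := he'
      rcases h with ⟨p, hp, i, rfl, rfl⟩ | ⟨p, hp, i, rfl, rfl⟩
      · exact Finset.mem_image.2 ⟨(p, i), by simp [hp], rfl⟩
      · exact Finset.mem_image.2 ⟨(p, i), by simp [hp], Sym2.eq_swap⟩
  refine (Finset.sum_le_sum_of_subset_of_nonneg hsub fun e _ _ => hd e).trans ?_
  refine (Finset.sum_image_le_of_nonneg fun e _ => hd e).trans ?_
  rw [Finset.sum_product]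
  exact le_rfl

theorem Quad.variation_sq_le (p : Quad) {c : ℝ} (hc : 0 < c) (h1 : ‖p.diag₁‖ / ‖p.diag₂‖ < c)
    (h2 : ‖p.diag₂‖ / ‖p.diag₁‖ < c) (h : 1 / c < p.diagAngle) (f : ℂ → ℝ) :
    p.variation f ^ 2 ≤
      64 * Real.pi * c ^ 2 * (‖p.gradient fun i => f (p.v i)‖ ^ 2 * p.area) := by
  have key := p.sq_add_sq_le hc h1 h2 h fun i => f (p.v i)
  have hv : p.variation f =
      2 * (|f (p.v 2) - f (p.v 0)| + |f (p.v 3) - f (p.v 1)|) := by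
    have e1 : (2 + 2 : Fin 4) = 0 := rfl
    have e2 : (3 + 2 : Fin 4) = 1 := rfl
    rw [variation, Fin.sum_univ_four, e1, e2, abs_sub_comm (f (p.v 0)), abs_sub_comm (f (p.v 1))]
    simp only [Fin.reduceAdd, zero_add]
    ring
  rw [hv]
  rw [← sq_abs (f (p.v 2) - f (p.v 0)), ← sq_abs (f (p.v 3) - f (p.v 1))] at key
  nlinarith [sq_nonneg (|f (p.v 2) - f (p.v 0)| - |f (p.v 3) - f (p.v 1)|)]

/-- A quadrilateral is not contained in finitely many lines of the direction `n`. -/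
theorem exists_mem_region_im_not_mem (p : Quad) {n : ℂ} (hn : ‖n‖ = 1) (F : Finset ℝ) :
    ∃ x ∈ p.region, (x * (starRingEnd ℂ) n).im ∉ F := by
  let π : ℂ →ₗ[ℝ] ℝ := Complex.imLm ∘ₗ LinearMap.mulRight ℝ ((starRingEnd ℂ) n)
  have hπ : ∀ x, π x = (x * (starRingEnd ℂ) n).im := fun x => rfl
  have hseg : ∀ a b, segment ℝ a b ⊆ p.region → π a ≠ π b → ∃ x ∈ p.region, π x ∉ F := by
    intro a b hab hne
    have hinf : (segment ℝ (π a) (π b)).Infinite := by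
      rw [segment_eq_uIcc, uIcc]
      exact Icc_infinite (by simpa using hne.symm)
    obtain ⟨t, ht, htF⟩ := hinf.exists_notMem_finset F
    rw [show segment ℝ (π a) (π b) = π '' segment ℝ a b from (image_segment ℝ π.toAffineMap a b).symm] at ht
    obtain ⟨x, hx, rfl⟩ := ht
    exact ⟨x, hab hx, htF⟩
  have hm : ∀ a b, a ∈ ({p.v 0, p.v 1, p.v 2} : Set ℂ) → b ∈ ({p.v 0, p.v 1, p.v 2} : Set ℂ) →
      segment ℝ a b ⊆ p.region := fun a b ha hb =>
    ((convex_convexHull ℝ _).segment_subset (subset_convexHull ℝ _ ha)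
      (subset_convexHull ℝ _ hb)).trans subset_union_left
  by_cases h1 : π (p.v 0) = π (p.v 1)
  · refine hseg (p.v 0) (p.v 2) (hm _ _ (by simp) (by simp)) fun h2 => ?_
    have hc := p.clockwise₁
    have hn' : n.re * n.re + n.im * n.im = 1 := by
      rw [← Complex.normSq_apply, Complex.normSq_eq_norm_sq, hn, one_pow]
    simp only [hπ, Complex.mul_im, Complex.conj_re, Complex.conj_im] at h1 h2
    have e1 : (p.v 1 - p.v 0).re * n.im = (p.v 1 - p.v 0).im * n.re := by simp; linarith
    have e2 : (p.v 2 - p.v 0).re * n.im = (p.v 2 - p.v 0).im * n.re := by simp; linarith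
    have : planeCross (p.v 1 - p.v 0) (p.v 2 - p.v 0) = 0 := by
      unfold planeCross
      generalize p.v 1 - p.v 0 = a at *
      generalize p.v 2 - p.v 0 = b at *
      linear_combination (a.im * b.re - a.re * b.im) * hn' +
        (b.re * n.re + b.im * n.im) * e1 - (a.re * n.re + a.im * n.im) * e2
    linarith
  · exact hseg (p.v 0) (p.v 1) (hm _ _ (by simp) (by simp)) h1

theorem Fin.four_cases_side (i j : Fin 4) :
    (i = j ∨ i + 1 = j) ∨ (i = j + 2 ∨ i + 1 = j + 2) := by
  revert i j; decide

namespace QuadLattice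

variable (Q : QuadLattice)

open Classical in
/-- The faces meeting the segment of length `L` issuing from `x` in the direction `n`. -/
noncomputable def facesAlong (x n : ℂ) (L : ℝ) : Finset Quad :=
  Q.faces.filter fun p => ∃ t ∈ Icc (0 : ℝ) L, x + t • n ∈ p.region

/-- Walking along a segment that avoids the vertices and leaves the lattice, one can follow the
diagonals of the faces met up to a vertex of the boundary. -/
theorem exists_reachable_boundary {p₀ : Quad} (hp₀ : p₀ ∈ Q.faces) (k : Fin 4) {x n : ℂ} {L : ℝ}
    (hx : x ∈ p₀.region) (hv : ∀ t : ℝ, x + t • n ∉ Q.vertices)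
    (hexit : ∃ s ∈ Icc (0 : ℝ) L, x + s • n ∉ Q.carrier) :
    ∃ p ∈ Q.facesAlong x n L, ∃ i, p.v i ∈ Q.boundary ∧
      (oppositeGraph (Q.facesAlong x n L)).Reachable (p₀.v k) (p.v i) := by
  classical
  set S := Q.facesAlong x n L with hS
  have hmemS : ∀ {p : Quad}, p ∈ S ↔ p ∈ Q.faces ∧ ∃ t ∈ Icc (0 : ℝ) L, x + t • n ∈ p.region := by
    intro p; simp [hS, facesAlong]
  obtain ⟨s, ⟨hs0, hsL⟩, hs⟩ := hexit
  set A : Set ℂ := {z | (oppositeGraph S).Reachable (p₀.v k) z} with hA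
  have hA2 : ∀ {p : Quad}, p ∈ S → ∀ i, p.v i ∈ A → p.v (i + 2) ∈ A := fun hp i h =>
    SimpleGraph.Reachable.trans h (Quad.reachable_add_two hp i)
  have hside : ∀ {p : Quad}, p ∈ S → (∃ i, p.v i ∈ A) → ∀ j, p.v j ∈ A ∨ p.v (j + 1) ∈ A := by
    rintro p hp ⟨i, hi⟩ j
    have hi2 := hA2 hp i hi
    rcases Fin.four_cases_side j i with (h | h) | (h | h)
    · exact .inl (h ▸ hi)
    · exact .inr (h ▸ hi)
    · exact .inl (h ▸ hi2)
    · exact .inr (h ▸ hi2)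
  set T : Finset Quad := S.filter fun p => ∃ i, p.v i ∈ A with hT
  have hmemT : ∀ {p : Quad}, p ∈ T ↔ p ∈ S ∧ ∃ i, p.v i ∈ A := by simp [hT]
  -- Faces sharing a non-vertex point of the segment with a face of `T` belong to `T`.
  have hspread : ∀ t ∈ Icc (0 : ℝ) L, ∀ p ∈ T, x + t • n ∈ p.region → ∀ q ∈ Q.faces,
      x + t • n ∈ q.region → q ∈ T := by
    intro t ht p hp hyp q hq hyq
    obtain ⟨hpS, hpA⟩ := hmemT.1 hp
    have hqS : q ∈ S := hmemS.2 ⟨hq, t, ht, hyq⟩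
    by_cases hpq : p = q
    · exact hpq ▸ hp
    obtain ⟨i, j, hij, -, -⟩ := Q.exists_common_side (hmemS.1 hpS).1 hq hpq hyp hyq (hv t)
    refine hmemT.2 ⟨hqS, ?_⟩
    rcases Quad.ends_of_side_eq hij with ⟨h1, h2⟩ | ⟨h1, h2⟩ <;>
    rcases hside hpS hpA i with h | h
    · exact ⟨j, h1 ▸ h⟩
    · exact ⟨j + 1, h2 ▸ h⟩
    · exact ⟨j + 1, h1 ▸ h⟩
    · exact ⟨j, h2 ▸ h⟩
  have hcont : Continuous fun t : ℝ => x + t • n := by fun_prop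
  set U : Set ℂ := ⋃ p ∈ T, p.region with hU
  have hUcl : IsClosed U := T.finite_toSet.isClosed_biUnion fun p _ => p.isCompact_region.isClosed
  have hmemU : ∀ {y}, y ∈ U ↔ ∃ p ∈ T, y ∈ p.region := by simp [hU]
  have hUc : U ⊆ Q.carrier := by
    intro y hy
    obtain ⟨p, hp, hy⟩ := hmemU.1 hy
    exact Q.region_subset_carrier (hmemS.1 (hmemT.1 hp).1).1 hy
  obtain ⟨t, ht, htU, htb⟩ : ∃ t ∈ Icc 0 L, x + t • n ∈ U ∧ x + t • n ∈ Q.boundary := by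
    by_contra! hne
    have hall : Icc 0 s ⊆ {t : ℝ | x + t • n ∈ U} := by
      refine IsClosed.Icc_subset_of_forall_exists_gt ((hUcl.preimage hcont).inter isClosed_Icc) ?_ ?_
      · have h0 : x + (0 : ℝ) • n ∈ p₀.region := by simpa using hx
        exact hmemU.2 ⟨p₀, hmemT.2 ⟨hmemS.2 ⟨hp₀, 0, ⟨le_rfl, hs0.trans hsL⟩, h0⟩,
          k, SimpleGraph.Reachable.refl _⟩, h0⟩
      · rintro t ⟨htU, ht0, hts⟩ y hy
        have htL : t ∈ Icc 0 L := ⟨ht0, hts.le.trans hsL⟩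
        obtain ⟨p, hp, hyp⟩ := hmemU.1 htU
        have hint : x + t • n ∈ interior Q.carrier := by
          by_contra h
          exact hne t htL htU ⟨subset_closure (hUc htU), h⟩
        have hev : ∀ᶠ t' in 𝓝 t, x + t' • n ∈ U := by
          filter_upwards [hcont.continuousAt.eventually (Q.eventually_mem_face (x + t • n)),
            hcont.continuousAt.eventually (mem_interior_iff_mem_nhds.1 hint)] with t' h1 h2
          obtain ⟨q, hq, h3⟩ := Q.mem_carrier_iff.1 h2
          exact hmemU.2 ⟨q, hspread t htL p hp hyp q hq (h1 q hq h3), h3⟩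
        have := (hev.filter_mono (nhdsWithin_le_nhds (s := Ioi t))).and (Ioc_mem_nhdsGT hy)
        exact this.exists
    exact hs (hUc (hall ⟨hs0, le_rfl⟩))
  obtain ⟨p, hp, hyp⟩ := hmemU.1 htU
  obtain ⟨hpS, hpA⟩ := hmemT.1 hp
  have hpQ := (hmemS.1 hpS).1
  obtain ⟨i, hi⟩ := p.exists_mem_side hyp fun h =>
    htb.2 (interior_mono (Q.region_subset_carrier hpQ) h)
  have hi' := p.mem_openSide_of_mem_side hi fun j hj => hv t (hj ▸ Q.v_mem_vertices hpQ j)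
  rcases hside hpS hpA i with h | h
  · exact ⟨p, hpS, i, Q.ends_mem_boundary hpQ hi' htb (.inl rfl), h⟩
  · exact ⟨p, hpS, i + 1, Q.ends_mem_boundary hpQ hi' htb (.inr rfl), h⟩

/-- The difference `z - w` lies in the rectangle with half-sides `L + 3h` in the direction `n` and
`3h` across it. -/
def Close (n : ℂ) (L : ℝ) (z w : ℂ) : Prop :=
  |((z - w) * (starRingEnd ℂ) n).re| ≤ L + 3 * Q.h ∧ |((z - w) * (starRingEnd ℂ) n).im| ≤ 3 * Q.h

theorem Close.symm {n : ℂ} {L : ℝ} {z w : ℂ} (h : Q.Close n L z w) : Q.Close n L w z := by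
  have : (w - z) * (starRingEnd ℂ) n = -((z - w) * (starRingEnd ℂ) n) := by ring
  rw [Close, this, Complex.neg_re, Complex.neg_im, abs_neg, abs_neg]
  exact h

theorem close_of_dist {n : ℂ} (hn : ‖n‖ = 1) {L t : ℝ} (ht : t ∈ Icc 0 L) {z w : ℂ}
    (h : ‖z - w - t • n‖ ≤ 3 * Q.h) : Q.Close n L z w := by
  have hnn : n * (starRingEnd ℂ) n = 1 := by
    rw [Complex.mul_conj, Complex.normSq_eq_norm_sq, hn]; simp
  set d := (z - w - t • n) * (starRingEnd ℂ) n with hd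
  have hdn : ‖d‖ ≤ 3 * Q.h := by
    rw [hd, norm_mul, Complex.norm_conj, hn, mul_one]; exact h
  have hzw : (z - w) * (starRingEnd ℂ) n = d + (t : ℂ) := by
    rw [hd, Complex.real_smul]
    linear_combination (t : ℂ) * hnn
  have h1 := (Complex.abs_re_le_norm d).trans hdn
  have h2 := (Complex.abs_im_le_norm d).trans hdn
  rw [Close, hzw]
  simp only [Complex.add_re, Complex.ofReal_re, Complex.add_im, Complex.ofReal_im, add_zero]
  refine ⟨(abs_add_le _ _).trans ?_, h2⟩
  rw [abs_of_nonneg ht.1]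
  linarith [ht.2]

/-- From a vertex one can follow the diagonals of faces near a segment up to a vertex of the
boundary. -/
theorem exists_chain {n : ℂ} (hn : ‖n‖ = 1) {L : ℝ} {z : ℂ} (hz : z ∈ Q.vertices)
    (hexit : ∀ x, dist x z ≤ Q.h → ∃ s ∈ Icc (0 : ℝ) L, x + s • n ∉ Q.carrier) :
    ∃ S ⊆ Q.faces, ∃ a ∈ Q.vertices, a ∈ Q.boundary ∧ Q.Close n L a z ∧
      (∀ p ∈ S, Q.Close n L (p.v 0) z) ∧ (oppositeGraph S).Reachable z a := by
  classical
  obtain ⟨p₀, hp₀, k, rfl⟩ := Q.mem_vertices_iff.1 hz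
  obtain ⟨x, hx, hxv⟩ := exists_mem_region_im_not_mem p₀ hn
    (Q.vertices.image fun w => (w * (starRingEnd ℂ) n).im)
  have hnn : n * (starRingEnd ℂ) n = 1 := by
    rw [Complex.mul_conj, Complex.normSq_eq_norm_sq, hn]; simp
  have hv : ∀ t : ℝ, x + t • n ∉ Q.vertices := by
    intro t ht
    refine hxv (Finset.mem_image.2 ⟨_, ht, ?_⟩)
    rw [Complex.real_smul, add_mul, mul_assoc, hnn, mul_one]
    simp
  have hxz := Q.dist_le_h hp₀ k hx
  obtain ⟨p, hp, i, hib, hr⟩ := Q.exists_reachable_boundary hp₀ k hx hv (hexit x hxz)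
  have hS : ∀ q ∈ Q.facesAlong x n L, q ∈ Q.faces ∧ ∀ j, Q.Close n L (q.v j) (p₀.v k) := by
    intro q hq
    obtain ⟨hqf, t, ht, hy⟩ := (Finset.mem_filter.1 hq)
    refine ⟨hqf, fun j => Q.close_of_dist hn ht ?_⟩
    have h1 := Q.dist_le_h hqf j hy
    rw [dist_eq_norm] at h1 hxz
    have e : q.v j - p₀.v k - t • n = (x - p₀.v k) - (x + t • n - q.v j) := by ring
    rw [e]
    have := norm_sub_le (x - p₀.v k) (x + t • n - q.v j)
    have := norm_nonneg (x - p₀.v k)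
    linarith
  exact ⟨_, fun q hq => (hS q hq).1, _, Q.v_mem_vertices (hS p hp).1 i, hib, (hS p hp).2 i,
    fun q hq => (hS q hq).2 0, hr⟩

end QuadLattice

theorem card_Icc_floor_le {X : ℝ} (hX : 0 ≤ X) :
    ((Finset.Icc ⌊-X⌋ ⌊X⌋).card : ℝ) ≤ 2 * X + 2 := by
  have h1 : ⌊-X⌋ ≤ ⌊X⌋ := Int.floor_mono (by linarith)
  rw [Int.card_Icc]
  have : (((⌊X⌋ + 1 - ⌊-X⌋).toNat : ℤ) : ℝ) = (⌊X⌋ : ℝ) + 1 - ⌊-X⌋ := by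
    rw [Int.toNat_of_nonneg (by lia)]; push_cast; rfl
  have h2 : (((⌊X⌋ + 1 - ⌊-X⌋).toNat : ℕ) : ℝ) = (⌊X⌋ : ℝ) + 1 - ⌊-X⌋ := by
    rw [← this]; norm_cast
  rw [h2]
  linarith [Int.floor_le X, Int.lt_floor_add_one (-X)]

namespace QuadLattice

variable (Q : QuadLattice)

theorem h_pos {p : Quad} (hp : p ∈ Q.faces) : 0 < Q.h := by
  have := Q.maxEdge_pos hp
  unfold h; linarith

open Classical in
theorem card_filter_close_le {c : ℝ} (hQ : Q.NondegenerateUniform c) {n : ℂ} (hn : ‖n‖ = 1)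
    {L : ℝ} (hh : 0 < Q.h) (hL : Q.h ≤ L) (x : ℂ) :
    ((Q.vertices.filter fun z => Q.Close n L z x).card : ℝ) ≤ 252 * c * (L / Q.h) := by
  set m := Q.maxEdge with hm
  have hhm : Q.h = 2 * m := rfl
  have hm0 : 0 < m := by linarith
  have hc0 : 0 ≤ c := (Nat.cast_nonneg _).trans (hQ.2 0).le
  have hnn : (starRingEnd ℂ) n * n = 1 := by
    rw [mul_comm, Complex.mul_conj, Complex.normSq_eq_norm_sq, hn]; simp
  set ξ : ℂ → ℂ := fun z => (z - x) * (starRingEnd ℂ) n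
  set X := (L + 3 * Q.h) / m
  set Y := 3 * Q.h / m
  have hX : X = L / m + 6 := by simp only [X, hhm]; field_simp; ring
  have hY : Y = 6 := by simp only [Y, hhm]; field_simp; ring
  have hLm : 2 ≤ L / m := by rw [le_div_iff₀ hm0]; linarith
  set T := Finset.Icc ⌊-X⌋ ⌊X⌋ ×ˢ Finset.Icc ⌊-Y⌋ ⌊Y⌋
  have hmaps : ∀ z ∈ Q.vertices.filter fun z => Q.Close n L z x,
      (⌊(ξ z).re / m⌋, ⌊(ξ z).im / m⌋) ∈ T := by
    intro z hz
    obtain ⟨h1, h2⟩ := (Finset.mem_filter.1 hz).2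
    rw [abs_le] at h1 h2
    have e : ∀ {u v : ℝ}, -v ≤ u → u ≤ v → ⌊u / m⌋ ∈ Finset.Icc ⌊-(v / m)⌋ ⌊v / m⌋ := by
      intro u v h1 h2
      rw [Finset.mem_Icc]
      refine ⟨Int.floor_mono ?_, Int.floor_mono ?_⟩
      · rw [← neg_div]; gcongr
      · gcongr
    exact Finset.mem_product.2 ⟨e h1.1 h1.2, e h2.1 h2.2⟩
  have hfib : ∀ b ∈ T, (((Q.vertices.filter fun z => Q.Close n L z x).filter fun z =>
      (⌊(ξ z).re / m⌋, ⌊(ξ z).im / m⌋) = b).card : ℝ) ≤ c := by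
    rintro ⟨b₁, b₂⟩ -
    set w : ℂ := x + ⟨m * (b₁ + 1 / 2), m * (b₂ + 1 / 2)⟩ * n with hw
    refine le_trans ?_ (hQ.2 w).le
    rw [← Set.ncard_coe_finset]
    gcongr
    · exact Q.vertices.finite_toSet.inter_of_left _
    intro z hz
    rw [Finset.mem_coe, Finset.mem_filter, Finset.mem_filter, Prod.mk.injEq] at hz
    obtain ⟨⟨hzv, -⟩, h1, h2⟩ := hz
    refine ⟨hzv, ?_⟩
    rw [Metric.mem_closedBall, dist_eq_norm]
    have e : z - w = (ξ z - ⟨m * (b₁ + 1 / 2), m * (b₂ + 1 / 2)⟩) * n := by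
      rw [hw]
      simp only [ξ]
      linear_combination (x - z) * hnn
    rw [e, norm_mul, hn, mul_one]
    have f : ∀ {u : ℝ} {b : ℤ}, ⌊u / m⌋ = b → |u - m * (b + 1 / 2)| ≤ m / 2 := by
      rintro u _ rfl
      have i1 := Int.floor_le (u / m)
      have i2 := Int.lt_floor_add_one (u / m)
      rw [le_div_iff₀ hm0] at i1
      rw [div_lt_iff₀ hm0] at i2
      rw [abs_le]
      constructor <;> linarith
    refine (Complex.norm_le_abs_re_add_abs_im _).trans ?_
    simp only [Complex.sub_re, Complex.sub_im]
    linarith [f h1, f h2]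
  have hcard : ((Q.vertices.filter fun z => Q.Close n L z x).card : ℝ) ≤ T.card * c := by
    rw [Finset.card_eq_sum_card_fiberwise hmaps]
    push_cast
    exact (Finset.sum_le_sum hfib).trans (by simp)
  have hT : (T.card : ℝ) ≤ (2 * X + 2) * (2 * Y + 2) := by
    rw [Finset.card_product]
    push_cast
    have hX0 : 0 ≤ X := by linarith
    have hY0 : 0 ≤ Y := by linarith
    gcongr
    · exact card_Icc_floor_le hX0
    · exact card_Icc_floor_le hY0
  have hT' : (2 * X + 2) * (2 * Y + 2) ≤ 126 * (L / m) := by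
    rw [hX, hY]; linarith
  calc _ ≤ T.card * c := hcard
    _ ≤ 126 * (L / m) * c := by gcongr; exact hT.trans hT'
    _ = 252 * c * (L / Q.h) := by rw [hhm]; field_simp; ring

open Classical in
/-- The number of faces starting at a given vertex is bounded. -/
theorem card_faces_at_le {c : ℝ} (hQ : Q.NondegenerateUniform c) (hh : 0 < Q.h) (z : ℂ) :
    ((Q.faces.filter fun p => p.v 0 = z).card : ℝ) ≤ (252 * c) ^ 4 := by
  set V := Q.vertices.filter fun w => Q.Close 1 Q.h w z
  have hV : (V.card : ℝ) ≤ 252 * c := by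
    simpa [hh.ne'] using Q.card_filter_close_le hQ (n := 1) (by simp) hh le_rfl z
  have hinj : (Q.faces.filter fun p => p.v 0 = z).card ≤
      (Fintype.piFinset fun _ : Fin 4 => V).card := by
    refine Finset.card_le_card_of_injOn (fun p => p.v) ?_ ?_
    · intro p hp
      obtain ⟨hpQ, rfl⟩ := Finset.mem_filter.1 hp
      rw [Finset.mem_coe, Fintype.mem_piFinset]
      intro i
      refine Finset.mem_filter.2 ⟨Q.v_mem_vertices hpQ i, ?_⟩
      refine Q.close_of_dist (by simp) (t := 0) ⟨le_rfl, hh.le⟩ ?_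
      have := Q.dist_le_h hpQ 0 (p.v_mem_region i)
      rw [dist_eq_norm] at this
      rw [zero_smul, sub_zero]
      linarith
    · intro p _ q _ h
      cases p; cases q; simp only at h; subst h; rfl
  rw [Fintype.card_piFinset_const] at hinj
  calc _ ≤ ((V.card ^ 4 : ℕ) : ℝ) := by exact_mod_cast hinj
    _ ≤ _ := by push_cast; gcongr

open Classical in
theorem card_filter_faces_close_le {c : ℝ} (hQ : Q.NondegenerateUniform c) {n : ℂ}
    (hn : ‖n‖ = 1) {L : ℝ} (hh : 0 < Q.h) (hL : Q.h ≤ L) (x : ℂ) :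
    ((Q.faces.filter fun p => Q.Close n L (p.v 0) x).card : ℝ) ≤ (252 * c) ^ 5 * (L / Q.h) := by
  have hmaps : ∀ p ∈ Q.faces.filter fun p => Q.Close n L (p.v 0) x,
      p.v 0 ∈ Q.vertices.filter fun z => Q.Close n L z x := by
    intro p hp
    obtain ⟨hp, hc⟩ := Finset.mem_filter.1 hp
    exact Finset.mem_filter.2 ⟨Q.v_mem_vertices hp 0, hc⟩
  have hc0 : 0 ≤ c := (Nat.cast_nonneg _).trans (hQ.2 0).le
  rw [Finset.card_eq_sum_card_fiberwise hmaps]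
  push_cast
  calc _ ≤ ∑ _z ∈ Q.vertices.filter fun z => Q.Close n L z x, (252 * c) ^ 4 := by
        refine Finset.sum_le_sum fun z _ => le_trans ?_ (Q.card_faces_at_le hQ hh z)
        gcongr
        exact Finset.filter_subset _ _
    _ = (Q.vertices.filter fun z => Q.Close n L z x).card * (252 * c) ^ 4 := by simp
    _ ≤ 252 * c * (L / Q.h) * (252 * c) ^ 4 := by
        gcongr
        exact Q.card_filter_close_le hQ hn hh hL x
    _ = _ := by ring

/-- The energy of the restriction to the vertices of a function on the plane. -/
noncomputable def planeEnergy (f : ℂ → ℝ) : ℝ :=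
  ∑ p ∈ Q.faces, ‖p.gradient fun i => f (p.v i)‖ ^ 2 * p.area

theorem planeEnergy_nonneg (f : ℂ → ℝ) : 0 ≤ Q.planeEnergy f :=
  Finset.sum_nonneg fun _ _ => mul_nonneg (sq_nonneg _) MeasureTheory.measureReal_nonneg

theorem h_nonneg : 0 ≤ Q.h :=
  mul_nonneg zero_le_two (Real.iSup_nonneg fun _ => dist_nonneg)

open Classical in
/-- The discrete Friedrichs inequality for vertices from which one leaves the lattice by moving in
a fixed direction. -/
theorem strip_inequality {c : ℝ} (hQ : Q.NondegenerateUniform c) {n : ℂ} (hn : ‖n‖ = 1) {L : ℝ}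
    (hL : Q.h ≤ L) (f : ℂ → ℝ) (B : Set ℂ)
    (hB : ∀ z ∈ B, ∀ w, (oppositeGraph Q.faces).Reachable z w → w ∈ B) (Z : Finset ℂ)
    (hZ : Z ⊆ Q.vertices) (hZB : ∀ z ∈ Z, z ∈ B)
    (hexit : ∀ z ∈ Z, ∀ x, dist x z ≤ Q.h → ∃ s ∈ Icc (0 : ℝ) L, x + s • n ∉ Q.carrier) :
    Q.h ^ 2 * ∑ z ∈ Z, f z ^ 2 ≤ 504 * c * (Q.h * L) *
      (∑ z ∈ Q.vertices.filter fun z => z ∈ B ∧ z ∈ Q.boundary, f z ^ 2) +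
      128 * Real.pi * c ^ 2 * (252 * c) ^ 6 * L ^ 2 * Q.planeEnergy f := by
  rcases Z.eq_empty_or_nonempty with rfl | ⟨z₀, hz₀⟩
  · have hc : 0 ≤ c := (Nat.cast_nonneg _).trans (hQ.2 0).le
    have hh := Q.h_nonneg
    have hL0 := hh.trans hL
    have hE := Q.planeEnergy_nonneg f
    rw [Finset.sum_empty, mul_zero]
    positivity
  obtain ⟨p₀, hp₀, -⟩ := Q.mem_vertices_iff.1 (hZ hz₀)
  have hh := Q.h_pos hp₀
  have hc : 0 < c := (by positivity : (0 : ℝ) ≤ ‖p₀.diag₁‖ / ‖p₀.diag₂‖).trans_lt (hQ.1 p₀ hp₀).1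
  have hL0 : 0 < L := hh.trans_le hL
  have hch : ∀ z ∈ Z, ∃ S ⊆ Q.faces, ∃ a ∈ Q.vertices, a ∈ Q.boundary ∧ Q.Close n L a z ∧
      (∀ p ∈ S, Q.Close n L (p.v 0) z) ∧ (oppositeGraph S).Reachable z a :=
    fun z hz => Q.exists_chain hn (hZ hz) (hexit z hz)
  choose! S hSQ a hav hab haz hSz hreach using hch
  set κ := 252 * c
  have hκ : 0 < κ := by positivity
  set D : Quad → ℝ := fun p => p.variation f
  set Bd := Q.vertices.filter fun z => z ∈ B ∧ z ∈ Q.boundary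
  have hmono : ∀ z ∈ Z, oppositeGraph (S z) ≤ oppositeGraph Q.faces := by
    intro z hz x y hxy
    refine ⟨hxy.1, hxy.2.imp ?_ ?_⟩ <;>
    · rintro ⟨p, hp, h⟩
      exact ⟨p, hSQ z hz hp, h⟩
  have haBd : ∀ z ∈ Z, a z ∈ Bd := fun z hz => Finset.mem_filter.2 ⟨hav z hz,
    hB z (hZB z hz) _ ((hreach z hz).mono (hmono z hz)), hab z hz⟩
  have hpoint : ∀ z ∈ Z,
      f z ^ 2 ≤ 2 * f (a z) ^ 2 + 2 * (κ ^ 5 * (L / Q.h) * ∑ p ∈ S z, D p ^ 2) := by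
    intro z hz
    have h1 := abs_sub_le_sum_variation f (hreach z hz)
    have h2 : (∑ p ∈ S z, D p) ^ 2 ≤ (S z).card * ∑ p ∈ S z, D p ^ 2 := sq_sum_le_card_mul_sum_sq
    have h3 : ((S z).card : ℝ) ≤ κ ^ 5 * (L / Q.h) := by
      refine le_trans ?_ (Q.card_filter_faces_close_le hQ hn hh hL z)
      gcongr
      exact fun p hp => Finset.mem_filter.2 ⟨hSQ z hz hp, hSz z hz p hp⟩
    have h4 : (f z - f (a z)) ^ 2 ≤ (∑ p ∈ S z, D p) ^ 2 := sq_le_sq' (abs_le.1 h1).1 (abs_le.1 h1).2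
    have h5 : ((S z).card : ℝ) * ∑ p ∈ S z, D p ^ 2 ≤
        κ ^ 5 * (L / Q.h) * ∑ p ∈ S z, D p ^ 2 := by
      gcongr
    nlinarith [sq_nonneg (f z - 2 * f (a z))]
  have hsumB : ∑ z ∈ Z, f (a z) ^ 2 ≤ κ * (L / Q.h) * ∑ b ∈ Bd, f b ^ 2 := by
    rw [← Finset.sum_fiberwise_of_maps_to haBd, Finset.mul_sum]
    refine Finset.sum_le_sum fun b _ => ?_
    rw [Finset.sum_congr rfl fun z hz => by rw [(Finset.mem_filter.1 hz).2], Finset.sum_const,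
      nsmul_eq_mul]
    gcongr
    refine le_trans ?_ (Q.card_filter_close_le hQ hn hh hL b)
    gcongr
    intro z hz
    obtain ⟨hzZ, rfl⟩ := Finset.mem_filter.1 hz
    exact Finset.mem_filter.2 ⟨hZ hzZ, (haz z hzZ).symm⟩
  have hsumD : ∑ z ∈ Z, ∑ p ∈ S z, D p ^ 2 ≤ κ * (L / Q.h) * ∑ p ∈ Q.faces, D p ^ 2 := by
    have h1 : ∀ z ∈ Z, ∑ p ∈ S z, D p ^ 2 = ∑ p ∈ Q.faces, if p ∈ S z then D p ^ 2 else 0 := by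
      intro z hz
      rw [← Finset.sum_filter, Finset.filter_mem_eq_inter, Finset.inter_eq_right.2 (hSQ z hz)]
    rw [Finset.sum_congr rfl h1, Finset.sum_comm, Finset.mul_sum]
    refine Finset.sum_le_sum fun p _ => ?_
    rw [← Finset.sum_filter, Finset.sum_const, nsmul_eq_mul]
    gcongr
    refine le_trans ?_ (Q.card_filter_close_le hQ hn hh hL (p.v 0))
    gcongr
    intro z hz
    obtain ⟨hz, hp⟩ := Finset.mem_filter.1 hz
    exact Finset.mem_filter.2 ⟨hZ hz, (hSz z hz p hp).symm⟩
  have hE : ∑ p ∈ Q.faces, D p ^ 2 ≤ 64 * Real.pi * c ^ 2 * Q.planeEnergy f := by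
    rw [planeEnergy, Finset.mul_sum]
    refine Finset.sum_le_sum fun p hp => ?_
    obtain ⟨h1, h2, h3⟩ := hQ.1 p hp
    exact p.variation_sq_le hc h1 h2 h3 f
  have hsum : ∑ z ∈ Z, f z ^ 2 ≤ 2 * ∑ z ∈ Z, f (a z) ^ 2 +
      2 * (κ ^ 5 * (L / Q.h) * ∑ z ∈ Z, ∑ p ∈ S z, D p ^ 2) := by
    refine (Finset.sum_le_sum hpoint).trans (le_of_eq ?_)
    rw [Finset.sum_add_distrib, ← Finset.mul_sum, ← Finset.mul_sum, ← Finset.mul_sum]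
  calc Q.h ^ 2 * ∑ z ∈ Z, f z ^ 2
      ≤ Q.h ^ 2 * (2 * (κ * (L / Q.h) * ∑ b ∈ Bd, f b ^ 2) + 2 * (κ ^ 5 * (L / Q.h) *
          (κ * (L / Q.h) * (64 * Real.pi * c ^ 2 * Q.planeEnergy f)))) := by
        gcongr
        refine hsum.trans ?_
        gcongr
        exact hsumD.trans (by gcongr)
    _ = _ := by
        simp only [κ]
        field_simp
        ring

end QuadLattice

/-- Near the point `p` the set `Ω` is a sublevel set of the 1-Lipschitz function `ψ`, which
increases in the direction `n`. -/
structure IsBoundaryChart (Ω : Set ℂ) (p n : ℂ) (ρ κ : ℝ) (ψ : ℂ → ℝ) : Prop where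
  norm_eq : ‖n‖ = 1
  radius_pos : 0 < ρ
  slope_pos : 0 < κ
  mem_iff : ∀ z ∈ Metric.ball p ρ, z ∈ Ω ↔ ψ z < 0
  lipschitz : ∀ x ∈ Metric.ball p ρ, ∀ y ∈ Metric.ball p ρ, |ψ x - ψ y| ≤ dist x y
  slope_le : ∀ x ∈ Metric.ball p ρ, ∀ s : ℝ, 0 ≤ s → x + s • n ∈ Metric.ball p ρ →
    ψ x + κ * s ≤ ψ (x + s • n)

theorem HasSmoothBoundary.exists_chart {Ω : Set ℂ} (hΩ : HasSmoothBoundary Ω) {p : ℂ}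
    (hp : p ∈ frontier Ω) : ∃ n ρ κ ψ, IsBoundaryChart Ω p n ρ κ ψ := by
  obtain ⟨φ, hφ, -, hD, hmem⟩ := hΩ p hp
  set D := fderiv ℝ φ p
  obtain ⟨n, hn, hη⟩ : ∃ n : ℂ, ‖n‖ = 1 ∧ 0 < D n := by
    obtain ⟨w, hw⟩ : ∃ w, D w ≠ 0 := by
      by_contra! h
      exact hD (by ext w; simpa using h w)
    have hw0 : w ≠ 0 := fun h => hw (by rw [h, map_zero])
    have hn0 : ‖w‖ ≠ 0 := norm_ne_zero_iff.2 hw0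
    rcases lt_or_gt_of_ne hw with h | h
    · refine ⟨-(‖w‖⁻¹ • w), by rw [norm_neg, norm_smul]; simp [hn0], ?_⟩
      rw [map_neg, map_smul, smul_eq_mul]
      have : 0 < ‖w‖⁻¹ := by positivity
      nlinarith
    · refine ⟨‖w‖⁻¹ • w, by rw [norm_smul]; simp [hn0], ?_⟩
      rw [map_smul, smul_eq_mul]
      positivity
  have hstrict : HasStrictFDerivAt φ D p := hφ.contDiffAt.hasStrictFDerivAt (by simp)
  have hlo := hstrict.isLittleO.def (half_pos hη)
  obtain ⟨ρ₁, hρ₁, h1⟩ := Metric.eventually_nhds_iff_ball.1 hlo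
  obtain ⟨ρ₂, hρ₂, h2⟩ := Metric.eventually_nhds_iff_ball.1 hmem
  have hb : ∀ x ∈ Metric.ball p (min ρ₁ ρ₂), ∀ y ∈ Metric.ball p (min ρ₁ ρ₂),
      |φ x - φ y - D (x - y)| ≤ D n / 2 * ‖x - y‖ := by
    intro x hx y hy
    refine h1 (x, y) ?_
    rw [← ball_prod_same]
    exact ⟨Metric.ball_subset_ball (min_le_left _ _) hx, Metric.ball_subset_ball (min_le_left _ _) hy⟩
  set l := ‖D‖ + D n / 2 with hl
  have hl0 : 0 < l := by positivity
  refine ⟨n, min ρ₁ ρ₂, D n / 2 / l, fun z => φ z / l, hn, lt_min hρ₁ hρ₂, by positivity, ?_, ?_, ?_⟩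
  · intro z hz
    rw [h2 z (Metric.ball_subset_ball (min_le_right _ _) hz), div_neg_iff]
    constructor
    · exact fun h => .inr ⟨h, hl0⟩
    · rintro (h | h)
      · linarith [h.2]
      · exact h.1
  · intro x hx y hy
    rw [← sub_div, abs_div, abs_of_pos hl0, div_le_iff₀ hl0, dist_eq_norm]
    have e1 := hb x hx y hy
    have e2 := D.le_opNorm (x - y)
    rw [Real.norm_eq_abs] at e2
    have e3 := abs_add_le (φ x - φ y - D (x - y)) (D (x - y))
    rw [sub_add_cancel] at e3
    rw [hl]
    linarith
  · intro x hx s hs hxs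
    have e1 := (abs_le.1 (hb _ hxs x hx)).1
    rw [add_sub_cancel_left, map_smul, norm_smul, hn, smul_eq_mul, Real.norm_of_nonneg hs] at e1
    rw [div_mul_eq_mul_div, ← add_div]
    gcongr
    linarith

namespace IsBoundaryChart

variable {Ω : Set ℂ} {p n : ℂ} {ρ κ : ℝ} {ψ : ℂ → ℝ}

theorem notMem_closure (h : IsBoundaryChart Ω p n ρ κ ψ) {x : ℂ} (hx : x ∈ Metric.ball p ρ)
    (hψ : 0 < ψ x) : x ∉ closure Ω := by
  intro hcl
  obtain ⟨y, ⟨hy1, hy2⟩, hyΩ⟩ := mem_closure_iff.1 hcl _ (Metric.isOpen_ball.inter Metric.isOpen_ball)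
    ⟨hx, Metric.mem_ball_self hψ⟩
  have h1 := (h.mem_iff y hy1).1 hyΩ
  have h2 := (abs_le.1 (h.lipschitz y hy1 x hx)).1
  rw [Metric.mem_ball] at hy2
  linarith

theorem eq_zero_of_mem_frontier (h : IsBoundaryChart Ω p n ρ κ ψ) (hΩ : IsOpen Ω) {x : ℂ}
    (hx : x ∈ Metric.ball p ρ) (hxΩ : x ∈ frontier Ω) : ψ x = 0 := by
  rw [hΩ.frontier_eq] at hxΩ
  refine le_antisymm (not_lt.1 fun h' => h.notMem_closure hx h' hxΩ.1) (not_lt.1 fun h' => ?_)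
  exact hxΩ.2 ((h.mem_iff x hx).2 h')

theorem pos_of_notMem_closure (h : IsBoundaryChart Ω p n ρ κ ψ) {x : ℂ}
    (hx : x ∈ Metric.ball p ρ) (hxΩ : x ∉ closure Ω) : 0 < ψ x := by
  by_contra! h0
  apply hxΩ
  have ht : Tendsto (fun t : ℝ => x - t • n) (𝓝[>] 0) (𝓝 x) := by
    have : Continuous (fun t : ℝ => x - t • n) := by fun_prop
    simpa using (this.tendsto 0).mono_left nhdsWithin_le_nhds
  refine mem_closure_of_tendsto ht ?_
  filter_upwards [ht.eventually (Metric.isOpen_ball.mem_nhds hx), self_mem_nhdsWithin] with t h1 h2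
  have := h.slope_le _ h1 t (le_of_lt h2) (by simpa using hx)
  rw [sub_add_cancel] at this
  refine (h.mem_iff _ h1).2 ?_
  have := mul_pos h.slope_pos h2
  linarith

theorem mem_closure_compl_closure (h : IsBoundaryChart Ω p n ρ κ ψ) (hΩ : IsOpen Ω)
    (hp : p ∈ frontier Ω) : p ∈ closure (closure Ω)ᶜ := by
  have hpρ := Metric.mem_ball_self (x := p) h.radius_pos
  have ht : Tendsto (fun t : ℝ => p + t • n) (𝓝[>] 0) (𝓝 p) := by
    have : Continuous (fun t : ℝ => p + t • n) := by fun_prop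
    simpa using (this.tendsto 0).mono_left nhdsWithin_le_nhds
  refine mem_closure_of_tendsto ht ?_
  filter_upwards [ht.eventually (Metric.isOpen_ball.mem_nhds hpρ), self_mem_nhdsWithin] with t h1 h2
  refine h.notMem_closure h1 ?_
  have h3 := h.slope_le p hpρ t (le_of_lt h2) h1
  rw [h.eq_zero_of_mem_frontier hΩ hpρ hp] at h3
  have := mul_pos h.slope_pos h2
  linarith

/-- A lower bound for the distance to `Ω` through the chart. -/
theorem le_infDist (h : IsBoundaryChart Ω p n ρ κ ψ) (hne : Ω.Nonempty) {x : ℂ} {d : ℝ}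
    (hx : x ∈ Metric.ball p (3 * ρ / 4)) (hd : d ≤ ρ / 4) (hψ : d ≤ ψ x) :
    d ≤ Metric.infDist x Ω := by
  rw [Metric.le_infDist hne]
  intro y hy
  have hρ := h.radius_pos
  rw [Metric.mem_ball] at hx
  by_cases hyp : y ∈ Metric.ball p ρ
  · have h1 := (h.mem_iff y hyp).1 hy
    have h2 := (abs_le.1 (h.lipschitz x (Metric.mem_ball.2 (by linarith)) y hyp)).2
    linarith
  · rw [Metric.mem_ball, not_lt] at hyp
    have := dist_triangle y x p
    rw [dist_comm y x] at this
    linarith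

theorem mem_ball_add (h : IsBoundaryChart Ω p n ρ κ ψ) {x : ℂ} {a s R : ℝ}
    (hx : dist x p ≤ a) (hs : 0 ≤ s) (has : a + s < R) : x + s • n ∈ Metric.ball p R := by
  rw [Metric.mem_ball]
  have h1 := dist_triangle (x + s • n) x p
  have h2 : dist (x + s • n) x = s := by
    rw [dist_eq_norm, add_sub_cancel_left, norm_smul, h.norm_eq, mul_one, Real.norm_of_nonneg hs]
  linarith

/-- Near a boundary point the exterior of `Ω` is contained in one component. -/
theorem exists_joinedIn (h : IsBoundaryChart Ω p n ρ κ ψ) (hΩ : IsOpen Ω) (hp : p ∈ frontier Ω) :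
    ∃ U ∈ 𝓝 p, ∃ q, ∀ y ∈ U, y ∉ closure Ω → JoinedIn (closure Ω)ᶜ y q := by
  have hρ := h.radius_pos
  have hκ := h.slope_pos
  set s := ρ / 4 with hs
  have hs0 : 0 < s := by positivity
  set ε := min (κ * s) s
  have hε : 0 < ε := by positivity
  have hpρ := Metric.mem_ball_self (x := p) hρ
  have hq1 : p + s • n ∈ Metric.ball p ρ :=
    h.mem_ball_add (dist_self p).le hs0.le (by linarith)
  have hq2 := h.slope_le p hpρ s hs0.le hq1
  rw [h.eq_zero_of_mem_frontier hΩ hpρ hp, zero_add] at hq2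
  have hball : Metric.ball (p + s • n) ε ⊆ (closure Ω)ᶜ := by
    intro y hy
    rw [Metric.mem_ball] at hy
    have hyp : y ∈ Metric.ball p ρ := by
      have h1 := dist_triangle y (p + s • n) p
      have h2 : dist (p + s • n) p = s := by
        rw [dist_eq_norm, add_sub_cancel_left, norm_smul, h.norm_eq, mul_one,
          Real.norm_of_nonneg hs0.le]
      have := min_le_right (κ * s) s
      rw [Metric.mem_ball]
      linarith
    refine h.notMem_closure hyp ?_
    have h1 := (abs_le.1 (h.lipschitz y hyp _ hq1)).1
    have := min_le_left (κ * s) s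
    linarith
  refine ⟨Metric.ball p ε, Metric.ball_mem_nhds p hε, p + s • n, fun y hy hyΩ => ?_⟩
  have hyd : dist y p ≤ s := (Metric.mem_ball.1 hy).le.trans (min_le_right _ _)
  have hyp : y ∈ Metric.ball p ρ := Metric.mem_ball.2 (by linarith)
  refine (JoinedIn.of_segment_subset (y := y + s • n) ?_).trans
    (JoinedIn.of_segment_subset (subset_trans ?_ hball))
  · rw [segment_eq_image']
    rintro _ ⟨t, ⟨ht0, ht1⟩, rfl⟩
    simp only [add_sub_cancel_left, smul_smul]
    have hts : 0 ≤ t * s := by positivity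
    have hm : y + (t * s) • n ∈ Metric.ball p ρ := h.mem_ball_add hyd hts (by nlinarith)
    refine h.notMem_closure hm ?_
    have := h.slope_le y hyp _ hts hm
    have := h.pos_of_notMem_closure hyp hyΩ
    have : 0 ≤ κ * (t * s) := by positivity
    linarith
  · refine (convex_ball _ _).segment_subset ?_ (Metric.mem_ball_self hε)
    rw [Metric.mem_ball, dist_add_right]
    exact hy

end IsBoundaryChart

theorem isPathConnected_setOf_lt_norm {R : ℝ} (hR : 0 < R) : IsPathConnected {z : ℂ | R < ‖z‖} := by
  have h : {z : ℂ | R < ‖z‖} = Complex.exp '' {z | Real.log R < z.re} := by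
    ext z
    constructor
    · intro hz
      have hz0 : z ≠ 0 := norm_pos_iff.1 (hR.trans hz)
      refine ⟨Complex.log z, ?_, Complex.exp_log hz0⟩
      rw [mem_ofPred_eq, Complex.log_re]
      exact Real.log_lt_log hR hz
    · rintro ⟨w, hw, rfl⟩
      rw [mem_ofPred_eq, Complex.norm_exp]
      exact (Real.log_lt_iff_lt_exp hR).1 hw
  rw [h]
  refine ((convex_halfSpace_re_gt _).isPathConnected ⟨(Real.log R + 1 : ℝ), ?_⟩).image
    Complex.continuous_exp
  simp only [mem_ofPred_eq, Complex.ofReal_re]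
  linarith

/-- The coordinate `z - x` has no continuous logarithm near infinity. -/
theorem no_log_near_infinity {l : ℂ → ℂ} (hl : Continuous l) {x : ℂ} {R : ℝ}
    (h : ∀ z, R < ‖z‖ → Complex.exp (l z) = z - x) : False := by
  set r : ℝ := |R| + ‖x‖ + 1
  have hr : 0 < r := by positivity
  set c : ℝ → ℂ := fun θ => x + r * Complex.exp (θ * Complex.I)
  have hc : ∀ θ, R < ‖c θ‖ := by
    intro θ
    have h1 := norm_sub_norm_le (r * Complex.exp (θ * Complex.I)) (-x)
    rw [sub_neg_eq_add, add_comm _ x, norm_neg, norm_mul, Complex.norm_exp_ofReal_mul_I, mul_one,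
      Complex.norm_real, Real.norm_of_nonneg hr.le] at h1
    have : R ≤ |R| := le_abs_self R
    change R < ‖x + r * Complex.exp (θ * Complex.I)‖
    simp only [r] at h1 ⊢
    linarith
  set k : ℝ → ℂ := fun θ => l (c θ) - θ * Complex.I
  have hk : ∀ θ, Complex.exp (k θ) = r := by
    intro θ
    rw [Complex.exp_sub, h _ (hc θ)]
    simp only [c, add_sub_cancel_left]
    exact mul_div_cancel_right₀ _ (Complex.exp_ne_zero _)
  have hkc : Continuous fun θ => (k θ).im := by
    simp only [k, c]
    fun_prop
  have h2 : (k (2 * Real.pi)).im = (k 0).im - 2 * Real.pi := by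
    have : c (2 * Real.pi) = c 0 := by simp [c]
    simp [k, this]
  obtain ⟨θ, -, hθ⟩ := intermediate_value_Icc' Real.two_pi_pos.le hkc.continuousOn
    (show (k 0).im - Real.pi ∈ Icc (k (2 * Real.pi)).im (k 0).im by
      rw [h2]; constructor <;> linarith [Real.pi_pos])
  obtain ⟨m, hm⟩ := Complex.exp_eq_exp_iff_exists_int.1 ((hk θ).trans (hk 0).symm)
  have := congrArg Complex.im hm
  simp [hθ] at this
  have h3 : ((2 * m + 1 : ℤ) : ℝ) = 0 := by
    push_cast
    have hpi := Real.pi_ne_zero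
    apply mul_right_cancel₀ hpi
    linarith
  have h4 : 2 * m + 1 = 0 := by exact_mod_cast h3
  omega

/-- The exterior of a bounded simply connected domain with smooth boundary is connected. -/
theorem joinedIn_exterior {Ω : Set ℂ} (hΩ : IsOpen Ω) (hsc : IsSimplyConnected Ω)
    (hsm : HasSmoothBoundary Ω) {R : ℝ} (hR : 0 < R) (hΩR : closure Ω ⊆ Metric.closedBall 0 R)
    {w : ℂ} (hw : R < ‖w‖) {x : ℂ} (hx : x ∉ closure Ω) : JoinedIn (closure Ω)ᶜ w x := by
  classical
  set E := (closure Ω)ᶜ with hE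
  have hEo : IsOpen E := isClosed_closure.isOpen_compl
  have hfar : {z : ℂ | R < ‖z‖} ⊆ E := fun z hz hzΩ => by
    have := hΩR hzΩ
    rw [mem_closedBall_zero_iff] at this
    exact absurd hz (not_lt.2 this)
  set E₁ := pathComponentIn E w with hE₁
  have hE₁o : IsOpen E₁ := hEo.pathComponentIn w
  have hfar₁ : {z : ℂ | R < ‖z‖} ⊆ E₁ :=
    (isPathConnected_setOf_lt_norm hR).subset_pathComponentIn hw hfar
  by_contra hxn
  set E₂ := E \ E₁ with hE₂
  have hE₂o : IsOpen E₂ := by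
    rw [isOpen_iff_mem_nhds]
    rintro y ⟨hyE, hy⟩
    filter_upwards [(hEo.pathComponentIn y).mem_nhds (mem_pathComponentIn_self hyE)] with z hz
    exact ⟨pathComponentIn_subset hz, fun hz1 => hy (JoinedIn.trans hz1 (JoinedIn.symm hz))⟩
  have hdisjE : Disjoint E₁ E₂ := disjoint_sdiff_right
  have hunion : E₁ ∪ E₂ = E := union_sdiff_cancel pathComponentIn_subset
  have hnotΩ : ∀ y ∈ closure E, y ∉ Ω := by
    intro y hy hyΩ
    obtain ⟨z, hz1, hz2⟩ := mem_closure_iff.1 hy Ω hΩ hyΩ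
    exact hz2 (subset_closure hz1)
  have hdisj : Disjoint (closure E₂) (closure E₁) := by
    rw [Set.disjoint_left]
    intro p hp2 hp1
    have h1 : p ∉ E₁ := fun h => (hdisjE.closure_right hE₁o).le_bot ⟨h, hp2⟩
    have h2 : p ∉ E₂ := fun h => (hdisjE.symm.closure_right hE₂o).le_bot ⟨h, hp1⟩
    have hpE : p ∉ E := fun h => by
      rw [← hunion] at h
      exact h.elim h1 h2
    have hpΩ : p ∉ Ω := hnotΩ p (closure_mono (hunion ▸ subset_union_left) hp1)
    have hpf : p ∈ frontier Ω := by
      rw [hΩ.frontier_eq]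
      exact ⟨not_not.1 hpE, hpΩ⟩
    obtain ⟨n, ρ, κ, ψ, hchart⟩ := hsm.exists_chart hpf
    obtain ⟨U, hU, q, hq⟩ := hchart.exists_joinedIn hΩ hpf
    obtain ⟨y₁, hy₁U, hy₁⟩ := mem_closure_iff_nhds.1 hp1 U hU
    obtain ⟨y₂, hy₂U, hy₂⟩ := mem_closure_iff_nhds.1 hp2 U hU
    have j1 := hq y₁ hy₁U (pathComponentIn_subset hy₁)
    have j2 := hq y₂ hy₂U hy₂.1
    exact hy₂.2 (JoinedIn.trans hy₁ (j1.trans j2.symm))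
  have hcover : ∀ z, z ∉ Ω → z ∈ closure E₂ ∨ z ∈ closure E₁ := by
    intro z hz
    have hzE : z ∈ closure E := by
      by_cases hzc : z ∈ closure Ω
      · have hzf : z ∈ frontier Ω := by
          rw [hΩ.frontier_eq]
          exact ⟨hzc, hz⟩
        obtain ⟨n, ρ, κ, ψ, hchart⟩ := hsm.exists_chart hzf
        exact hchart.mem_closure_compl_closure hΩ hzf
      · exact subset_closure hzc
    rw [← hunion, closure_union] at hzE
    exact hzE.symm
  obtain ⟨φ, hφ0, hφ1, -⟩ := exists_continuous_zero_one_of_isClosed isClosed_closure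
    isClosed_closure hdisj
  obtain ⟨L, hLc, hL⟩ := Complex.exists_continuousOn_eqOn_exp_comp hsc hΩ
    (g := fun z => z - x) (by fun_prop) (by
      rintro ⟨z, hz, hzx⟩
      rw [sub_eq_zero.1 hzx] at hz
      exact hx (subset_closure hz))
  set τ : ℂ → ℝ := fun z => max 0 (min 1 (3 * φ z - 1))
  have hτ : Continuous τ := by fun_prop
  set G : ℂ → ℂ := fun z =>
    if z ∈ Ω then Complex.exp (τ z * L z) else if φ z < 1 / 2 then 1 else z - x
  have hx2 : x ∈ E₂ := ⟨hx, hxn⟩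
  have hφx : φ x = 0 := hφ0 (subset_closure hx2)
  have hGc : Continuous G := by
    rw [continuous_iff_continuousAt]
    intro z
    by_cases hz : z ∈ Ω
    · have h1 : ContinuousAt (fun z => Complex.exp (τ z * L z)) z := by
        have := hLc.continuousAt (hΩ.mem_nhds hz)
        have := hτ.continuousAt (x := z)
        fun_prop
      refine h1.congr ?_
      filter_upwards [hΩ.mem_nhds hz] with y hy
      simp [G, hy]
    · rcases hcover z hz with h | h
      · have h0 : φ z = 0 := hφ0 h
        refine (continuousAt_const (y := (1 : ℂ))).congr ?_
        filter_upwards [φ.continuous.continuousAt.eventually_lt_const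
          (show φ z < 1 / 3 by rw [h0]; norm_num)] with y hy
        have hτ0 : τ y = 0 := by
          have : min 1 (3 * φ y - 1) ≤ 0 := (min_le_right _ _).trans (by linarith)
          exact max_eq_left this
        have hy2 : φ y < 1 / 2 := by linarith
        simp only [G, hτ0, if_pos hy2]
        simp
      · have h1 : φ z = 1 := hφ1 h
        have hc : ContinuousAt (fun z => z - x) z := by fun_prop
        refine hc.congr ?_
        filter_upwards [φ.continuous.continuousAt.eventually_const_lt
          (show 2 / 3 < φ z by rw [h1]; norm_num)] with y hy
        have hτ1 : τ y = 1 := by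
          have : min 1 (3 * φ y - 1) = 1 := min_eq_left (by linarith)
          simp [τ, this]
        have hy2 : ¬ φ y < 1 / 2 := by linarith
        simp only [G, hτ1, if_neg hy2]
        split_ifs with hyΩ
        · simpa using (hL hyΩ).symm
        · rfl
  have hG0 : ∀ z, G z ≠ 0 := by
    intro z
    simp only [G]
    split_ifs with h1 h2
    · exact Complex.exp_ne_zero _
    · exact one_ne_zero
    · intro h3
      rw [sub_eq_zero.1 h3, hφx] at h2
      norm_num at h2
  have huniv : IsSimplyConnected (univ : Set ℂ) := by
    have := (Homeomorph.Set.univ ℂ).contractibleSpace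
    exact SimplyConnectedSpace.ofContractible _
  obtain ⟨l, hlc, hl⟩ := Complex.exists_continuousOn_eqOn_exp_comp huniv isOpen_univ
    (g := G) hGc.continuousOn (by rintro ⟨z, -, hz⟩; exact hG0 z hz)
  refine no_log_near_infinity (continuousOn_univ.1 hlc) (x := x) (R := R) fun z hz => ?_
  have h1 : φ z = 1 := hφ1 (subset_closure (hfar₁ hz))
  have hzΩ : z ∉ Ω := fun h => hfar hz (subset_closure h)
  have := hl (mem_univ z)
  simp only [Function.comp_apply] at this
  rw [this]
  simp only [G, if_neg hzΩ, h1]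
  norm_num

theorem IsPreconnected.notMem_of_frontier {T A : Set ℂ} (hT : IsPreconnected T)
    (hA : ∀ z ∈ T, z ∉ frontier A) {x w : ℂ} (hx : x ∈ T) (hw : w ∈ T) (hwA : w ∉ A) : x ∉ A := by
  intro hxA
  have hcov : T ⊆ interior A ∪ (closure A)ᶜ := by
    intro z hz
    by_cases h1 : z ∈ closure A
    · exact .inl (not_not.1 fun h2 => hA z hz ⟨h1, h2⟩)
    · exact .inr h1
  have hint : x ∈ interior A := not_not.1 fun h => hA x hx ⟨subset_closure hxA, h⟩
  have hsub := hT.subset_left_of_subset_union isOpen_interior isClosed_closure.isOpen_compl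
    (disjoint_compl_right.mono_left (interior_subset.trans subset_closure)) hcov ⟨x, hx, hint⟩
  exact hwA (interior_subset (hsub hw))

/-- Points at a definite distance from `Ω` can be uniformly joined to infinity away from `Ω`. -/
theorem exists_uniform_escape {Ω : Set ℂ} (hΩ : IsOpen Ω) (hsc : IsSimplyConnected Ω)
    (hsm : HasSmoothBoundary Ω) {R : ℝ} (hR : 0 < R) (hΩR : closure Ω ⊆ Metric.closedBall 0 R)
    {w : ℂ} (hw : R < ‖w‖) {d : ℝ} (hd : 0 < d) (R₁ : ℝ) :
    ∃ δ > 0, ∀ y, ‖y‖ ≤ R₁ → d ≤ Metric.infDist y Ω →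
      ∃ T, IsPreconnected T ∧ y ∈ T ∧ w ∈ T ∧ ∀ t ∈ T, δ ≤ Metric.infDist t Ω := by
  have hne := hsc.nonempty
  have hpos : ∀ {z}, z ∉ closure Ω → 0 < Metric.infDist z Ω := fun hz => by
    rw [← Metric.infDist_closure]
    exact (isClosed_closure.notMem_iff_infDist_pos hne.closure).1 hz
  set P : Set ℂ := Metric.closedBall 0 R₁ ∩ {y | d ≤ Metric.infDist y Ω} with hP
  have hPc : IsCompact P := (isCompact_closedBall 0 R₁).inter_right
    (isClosed_le continuous_const (Metric.continuous_infDist_pt Ω))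
  have hloc : ∀ y ∈ P, ∃ U ∈ 𝓝 y, ∃ δ > 0, ∀ x ∈ U,
      ∃ T, IsPreconnected T ∧ x ∈ T ∧ w ∈ T ∧ ∀ t ∈ T, δ ≤ Metric.infDist t Ω := by
    rintro y ⟨-, hy⟩
    rw [mem_ofPred_eq] at hy
    have hyc : y ∉ closure Ω := fun h => by
      rw [← Metric.infDist_closure, Metric.infDist_zero_of_mem h] at hy
      linarith
    obtain ⟨γ, hγ⟩ := joinedIn_exterior hΩ hsc hsm hR hΩR hw hyc
    have hγc : IsCompact (range γ) := isCompact_range γ.continuous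
    obtain ⟨t₀, ht₀, hmin⟩ := hγc.exists_isMinOn ⟨γ 0, mem_range_self 0⟩
      (Metric.continuous_infDist_pt Ω).continuousOn
    obtain ⟨s₀, rfl⟩ := ht₀
    refine ⟨Metric.ball y (d / 2), Metric.ball_mem_nhds y (by positivity),
      min (d / 2) (Metric.infDist (γ s₀) Ω), lt_min (by positivity) (hpos (hγ s₀)), fun x hx => ?_⟩
    have hyb : y ∈ Metric.ball y (d / 2) := Metric.mem_ball_self (by positivity)
    refine ⟨Metric.ball y (d / 2) ∪ range γ, ?_, .inl hx, .inr ⟨0, γ.source⟩, ?_⟩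
    · exact (convex_ball y (d / 2)).isPreconnected.union y hyb ⟨1, γ.target⟩
        (isPreconnected_range γ.continuous)
    · rintro t (ht | ht)
      · refine (min_le_left _ _).trans ?_
        have := Metric.infDist_le_infDist_add_dist (s := Ω) (x := y) (y := t)
        rw [Metric.mem_ball, dist_comm] at ht
        linarith
      · exact (min_le_right _ _).trans (hmin ht)
  choose! U hU δ hδ hT using hloc
  obtain ⟨F, hFP, hF⟩ := hPc.elim_nhds_subcover U hU
  have hδ₀ : ∀ᶠ ε in 𝓝[>] (0 : ℝ), ∀ i ∈ F, ε < δ i := by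
    rw [Finset.eventually_all]
    exact fun i hi => nhdsWithin_le_nhds (eventually_lt_nhds (hδ i (hFP i hi)))
  obtain ⟨ε, hε, hε0⟩ := (hδ₀.and self_mem_nhdsWithin).exists
  refine ⟨ε, hε0, fun y hy hyd => ?_⟩
  obtain ⟨i, hi, hyi⟩ := mem_iUnion₂.1 (hF (⟨mem_closedBall_zero_iff.2 hy, hyd⟩ : y ∈ P))
  obtain ⟨T, h1, h2, h3, h4⟩ := hT i (hFP i hi) y hyi
  exact ⟨T, h1, h2, h3, fun t ht => (hε i hi).le.trans (h4 t ht)⟩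

/-- Moving by a multiple of `r` in the direction of the chart leads out of `Ω` to a point that can
be joined to infinity away from the `r`-neighbourhood of `Ω`. -/
theorem exists_local_escape {Ω : Set ℂ} (hΩ : IsOpen Ω) (hsc : IsSimplyConnected Ω)
    (hsm : HasSmoothBoundary Ω) {R : ℝ} (hR : 0 < R) (hΩR : closure Ω ⊆ Metric.closedBall 0 R)
    {w : ℂ} (hw : R < ‖w‖) {p₀ : ℂ} (hp₀ : p₀ ∈ frontier Ω) :
    ∃ n : ℂ, ‖n‖ = 1 ∧ ∃ σ > 0, ∃ M ≥ (0 : ℝ), ∃ r₀ > 0, ∀ p ∈ frontier Ω, dist p p₀ < σ →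
      ∀ r, 0 < r → r < r₀ → ∀ x, dist x p ≤ 2 * r →
      ∃ T, IsPreconnected T ∧ x + (M * r) • n ∈ T ∧ w ∈ T ∧ ∀ t ∈ T, r ≤ Metric.infDist t Ω := by
  obtain ⟨n, ρ, κ, ψ, hc⟩ := hsm.exists_chart hp₀
  have hρ := hc.radius_pos
  have hκ := hc.slope_pos
  have hne := hsc.nonempty
  set d := min (κ * ρ / 8) (ρ / 4) with hd
  have hd0 : 0 < d := by positivity
  obtain ⟨δ, hδ, hT⟩ := exists_uniform_escape hΩ hsc hsm hR hΩR hw hd0 (R + ρ)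
  refine ⟨n, hc.norm_eq, ρ / 4, by positivity, 3 / κ, by positivity,
    min (min (ρ / 16) (κ * ρ / 16)) δ, by positivity, ?_⟩
  intro p hp hpp₀ r hr hrr x hx
  obtain ⟨hr1, hr3⟩ := lt_min_iff.1 hrr
  obtain ⟨hr1, hr2⟩ := lt_min_iff.1 hr1
  have hxp₀ : dist x p₀ ≤ 3 * ρ / 8 := by
    have := dist_triangle x p p₀
    linarith
  have hxb : x ∈ Metric.ball p₀ ρ := Metric.mem_ball.2 (by linarith)
  have hpb : p ∈ Metric.ball p₀ ρ := Metric.mem_ball.2 (by linarith)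
  have hψx : -(2 * r) ≤ ψ x := by
    have h1 := (abs_le.1 (hc.lipschitz x hxb p hpb)).1
    rw [hc.eq_zero_of_mem_frontier hΩ hpb hp] at h1
    linarith
  have hMr : 3 / κ * r ≤ ρ / 4 := by
    rw [div_mul_eq_mul_div, div_le_iff₀ hκ]
    linarith
  have hstep : ∀ s, 0 ≤ s → s ≤ ρ / 4 → x + s • n ∈ Metric.ball p₀ (3 * ρ / 4) ∧
      κ * s - 2 * r ≤ ψ (x + s • n) := by
    intro s hs hs'
    refine ⟨hc.mem_ball_add hxp₀ hs (by linarith), ?_⟩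
    have := hc.slope_le x hxb s hs (hc.mem_ball_add hxp₀ hs (by linarith))
    linarith
  have hend : d ≤ Metric.infDist (x + (ρ / 4) • n) Ω := by
    obtain ⟨h1, h2⟩ := hstep (ρ / 4) (by positivity) le_rfl
    exact hc.le_infDist hne h1 (min_le_right _ _) ((min_le_left _ _).trans (by linarith))
  have hnorm : ‖x + (ρ / 4) • n‖ ≤ R + ρ := by
    have h1 := (hstep (ρ / 4) (by positivity) le_rfl).1
    rw [Metric.mem_ball, dist_eq_norm] at h1
    have h2 := mem_closedBall_zero_iff.1 (hΩR (frontier_subset_closure hp₀))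
    have h3 := norm_le_norm_add_norm_sub' (x + (ρ / 4) • n) p₀
    linarith
  obtain ⟨T, hTc, hyT, hwT, hTd⟩ := hT _ hnorm hend
  refine ⟨(fun s : ℝ => x + s • n) '' Icc (3 / κ * r) (ρ / 4) ∪ T, ?_,
    .inl ⟨_, ⟨le_rfl, hMr⟩, rfl⟩, .inr hwT, ?_⟩
  · refine IsPreconnected.union (x + (ρ / 4) • n) ⟨_, ⟨hMr, le_rfl⟩, rfl⟩ hyT ?_ hTc
    exact isPreconnected_Icc.image _ (by fun_prop)
  · rintro t (⟨s, ⟨hs1, hs2⟩, rfl⟩ | ht)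
    · have hs0 : 0 ≤ s := le_trans (by positivity) hs1
      obtain ⟨h1, h2⟩ := hstep s hs0 hs2
      refine hc.le_infDist hne h1 (by linarith) (le_trans ?_ h2)
      rw [div_mul_eq_mul_div, div_le_iff₀ hκ] at hs1
      linarith
    · exact hr3.le.trans (hTd t ht)

theorem frontier_nonempty_of_isBounded {Ω : Set ℂ} (hne : Ω.Nonempty)
    (hb : Bornology.IsBounded Ω) : (frontier Ω).Nonempty :=
  nonempty_frontier_iff.2 ⟨hne, fun h => NormedSpace.unbounded_univ ℝ ℂ (h ▸ hb)⟩

/-- Finitely many directions suffice to leave any compact set with boundary close to `∂Ω`. -/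
theorem exists_directions {Ω : Set ℂ} (hΩ : IsOpen Ω) (hb : Bornology.IsBounded Ω)
    (hsc : IsSimplyConnected Ω) (hsm : HasSmoothBoundary Ω) :
    ∃ (N : Finset ℂ) (M : ℝ), (∀ n ∈ N, ‖n‖ = 1) ∧ 1 ≤ M ∧ ∀ (A : Set ℂ) (r : ℝ), IsCompact A →
      0 < r → (∀ z ∈ frontier A, Metric.infDist z (frontier Ω) < r) →
      ∀ z ∈ Ω, Metric.infDist z (frontier Ω) ≤ r → ∃ n ∈ N, ∀ x, dist x z ≤ r →
      ∃ s ∈ Icc (0 : ℝ) (M * r), x + s • n ∉ A := by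
  classical
  have hne := hsc.nonempty
  have hfne := frontier_nonempty_of_isBounded hne hb
  have hfc : IsCompact (frontier Ω) :=
    Metric.isCompact_of_isClosed_isBounded isClosed_frontier (hb.closure.subset frontier_subset_closure)
  obtain ⟨R', hR'⟩ := hb.closure.subset_closedBall 0
  set R := max R' 1
  have hR : 0 < R := lt_of_lt_of_le one_pos (le_max_right _ _)
  have hΩR : closure Ω ⊆ Metric.closedBall 0 R :=
    hR'.trans (Metric.closedBall_subset_closedBall (le_max_left _ _))
  set w : ℂ := ((R + 2 : ℝ) : ℂ)
  have hwn : ‖w‖ = R + 2 := by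
    rw [Complex.norm_real, Real.norm_of_nonneg (by linarith)]
  have hloc := fun (p : ℂ) (hp : p ∈ frontier Ω) =>
    exists_local_escape hΩ hsc hsm hR hΩR (w := w) (by linarith) hp
  choose! n hn σ hσ m hm r₀ hr₀ hesc using hloc
  obtain ⟨F, hFf, hF⟩ := hfc.elim_nhds_subcover (fun p => Metric.ball p (σ p))
    fun p hp => Metric.ball_mem_nhds p (hσ p hp)
  obtain ⟨ρ, hρ, hρ0⟩ : ∃ ρ : ℝ, (∀ i ∈ F, ρ < r₀ i) ∧ 0 < ρ := by
    have : ∀ᶠ ε in 𝓝[>] (0 : ℝ), ∀ i ∈ F, ε < r₀ i := by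
      rw [Finset.eventually_all]
      exact fun i hi => nhdsWithin_le_nhds (eventually_lt_nhds (hr₀ i (hFf i hi)))
    exact (this.and self_mem_nhdsWithin).exists
  set ρ₁ := min ρ 1
  have hρ₁ : 0 < ρ₁ := lt_min hρ0 one_pos
  obtain ⟨M', hM'⟩ := (F.image m).exists_le
  set M := max M' (2 * R / ρ₁ + 4)
  have hM1 : 2 * R / ρ₁ + 4 ≤ M := le_max_right _ _
  have hRρ : 0 ≤ 2 * R / ρ₁ := by positivity
  refine ⟨insert 1 (F.image n), M, ?_, by linarith, ?_⟩
  · intro k hk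
    rcases Finset.mem_insert.1 hk with rfl | hk
    · exact norm_one
    · obtain ⟨i, hi, rfl⟩ := Finset.mem_image.1 hk
      exact hn i (hFf i hi)
  intro A r hA hr hAr z hz hzr
  have hAinf : ∀ y ∈ frontier A, Metric.infDist y Ω < r := by
    intro y hy
    rw [← Metric.infDist_closure]
    exact (Metric.infDist_le_infDist_of_subset frontier_subset_closure hfne).trans_lt (hAr y hy)
  have hAR : ∀ y, R + r < ‖y‖ → y ∉ A := by
    intro y hy
    obtain ⟨RA, hRA⟩ := hA.isBounded.subset_closedBall 0
    have hpos : 0 < R + r := by linarith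
    have hfar : R + r < ‖((max (R + r) RA + 1 : ℝ) : ℂ)‖ ∧
        RA < ‖((max (R + r) RA + 1 : ℝ) : ℂ)‖ := by
      have h1 := le_max_left (R + r) RA
      have h2 := le_max_right (R + r) RA
      rw [Complex.norm_real, Real.norm_of_nonneg (by linarith)]
      constructor <;> linarith
    refine (isPathConnected_setOf_lt_norm hpos).isConnected.isPreconnected.notMem_of_frontier ?_ hy
      hfar.1 fun h => ?_
    · intro t ht htA
      obtain ⟨q, hq, hqt⟩ := (Metric.infDist_lt_iff hfne).1 (hAr t htA)
      have h1 := mem_closedBall_zero_iff.1 (hΩR (frontier_subset_closure hq))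
      rw [dist_eq_norm] at hqt
      have h2 := norm_le_norm_add_norm_sub' t q
      rw [mem_ofPred_eq] at ht
      linarith
    · have := mem_closedBall_zero_iff.1 (hRA h)
      linarith [hfar.2]
  by_cases hrρ : r < ρ₁
  · obtain ⟨p, hp, hpz⟩ := hfc.exists_infDist_eq_dist hfne z
    obtain ⟨i, hi, hpi⟩ := mem_iUnion₂.1 (hF hp)
    refine ⟨n i, Finset.mem_insert_of_mem (Finset.mem_image_of_mem n hi), fun x hx => ?_⟩
    have hxp : dist x p ≤ 2 * r := by
      have := dist_triangle x z p
      linarith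
    obtain ⟨T, hTc, hxT, hwT, hTr⟩ := hesc i (hFf i hi) p hp hpi r hr
      ((hrρ.trans_le (min_le_left _ _)).trans (hρ i hi)) x hxp
    have hmM : m i ≤ M := (hM' _ (Finset.mem_image_of_mem m hi)).trans (le_max_left _ _)
    refine ⟨m i * r, ⟨mul_nonneg (hm i (hFf i hi)) hr.le, by gcongr⟩, ?_⟩
    refine hTc.notMem_of_frontier (fun t ht htA => ?_) hxT hwT (hAR w ?_)
    · exact absurd (hAinf t htA) (not_lt.2 (hTr t ht))
    · rw [hwn]
      have := min_le_right ρ 1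
      linarith
  · refine ⟨1, Finset.mem_insert_self _ _, fun x hx => ⟨M * r, ⟨?_, le_rfl⟩, hAR _ ?_⟩⟩
    · exact mul_nonneg (by linarith) hr.le
    · rw [not_lt] at hrρ
      have h1 := mem_closedBall_zero_iff.1 (hΩR (subset_closure hz))
      rw [dist_eq_norm] at hx
      have h2 := norm_le_norm_add_norm_sub' x z
      have h3 : (2 * R / ρ₁ + 4) * r ≤ M * r := by gcongr
      have h4 : 2 * R ≤ 2 * R / ρ₁ * r := by
        rw [div_mul_eq_mul_div, le_div_iff₀ hρ₁]
        gcongr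
      have hMr : 0 ≤ M * r := mul_nonneg (by linarith) hr.le
      have h5 := norm_sub_norm_le ((M * r) • (1 : ℂ)) (-x)
      rw [sub_neg_eq_add, norm_neg, norm_smul, norm_one, mul_one, Real.norm_of_nonneg hMr,
        add_comm _ x] at h5
      linarith

theorem Quad.diagAngle_pos (p : Quad) : 0 < p.diagAngle := by
  have h := sin_angle_mul_norm p.diag₁ p.diag₂
  have hcr := abs_pos.2 p.planeCross_diag_neg.ne
  rw [← h] at hcr
  have hne : Real.sin (InnerProductGeometry.angle p.diag₁ p.diag₂) ≠ 0 := fun h0 => by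
    rw [h0, zero_mul] at hcr
    exact lt_irrefl _ hcr
  refine lt_min ?_ (sub_pos.2 ?_)
  · refine (InnerProductGeometry.angle_nonneg _ _).lt_of_ne fun h0 => hne ?_
    rw [← h0, Real.sin_zero]
  · refine (InnerProductGeometry.angle_le_pi _ _).lt_of_ne fun h0 => hne ?_
    rw [h0, Real.sin_pi]

namespace QuadLattice

variable (Q : QuadLattice)

theorem eventually_nondegenerateUniform : ∀ᶠ c in atTop, Q.NondegenerateUniform c := by
  have h1 : ∀ᶠ c : ℝ in atTop, ∀ p ∈ Q.faces, ‖p.diag₁‖ / ‖p.diag₂‖ < c ∧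
      ‖p.diag₂‖ / ‖p.diag₁‖ < c ∧ 1 / c < p.diagAngle := by
    rw [Finset.eventually_all]
    intro p _
    refine (eventually_gt_atTop _).and ((eventually_gt_atTop _).and ?_)
    have : Tendsto (fun c : ℝ => 1 / c) atTop (𝓝 0) := by
      simpa using tendsto_inv_atTop_zero (𝕜 := ℝ)
    exact this.eventually_lt_const p.diagAngle_pos
  filter_upwards [h1, eventually_gt_atTop (Q.vertices.card : ℝ)] with c hc hcard
  refine ⟨hc, fun w => lt_of_le_of_lt ?_ hcard⟩
  rw [← Set.ncard_coe_finset]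
  exact_mod_cast Set.ncard_le_ncard inter_subset_left Q.vertices.finite_toSet

theorem nondegenerateUniform_of_eccentricity_lt {p : Quad} (hp : p ∈ Q.faces) {c : ℝ}
    (hc : Q.eccentricity < c) : Q.NondegenerateUniform c := by
  obtain ⟨s, hs, hsc⟩ := exists_lt_of_csInf_lt Q.eventually_nondegenerateUniform.exists hc
  have hs0 : 0 < s := (by positivity : (0 : ℝ) ≤ ‖p.diag₁‖ / ‖p.diag₂‖).trans_lt (hs.1 p hp).1
  refine ⟨fun q hq => ?_, fun w => (hs.2 w).trans hsc⟩
  obtain ⟨h1, h2, h3⟩ := hs.1 q hq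
  exact ⟨h1.trans hsc, h2.trans hsc, (one_div_le_one_div_of_le hs0 hsc.le).trans_lt h3⟩

/-- The vertex set of a component of the graph of diagonals, as a set of points. -/
def componentSet (B : Q.diagGraph.ConnectedComponent) : Set ℂ :=
  {z | ∃ h : z ∈ Q.vertices, (⟨z, h⟩ : Q.vertices) ∈ B.supp}

theorem mem_componentSet_of_reachable (B : Q.diagGraph.ConnectedComponent) {z w : ℂ}
    (hz : z ∈ Q.componentSet B) (h : (oppositeGraph Q.faces).Reachable z w) :
    w ∈ Q.componentSet B := by
  obtain ⟨γ⟩ := h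
  induction γ with
  | nil => exact hz
  | @cons a b c hab γ ih =>
    refine ih ?_
    obtain ⟨ha, haB⟩ := hz
    have hb : b ∈ Q.vertices := by
      rcases hab.2 with ⟨p, hp, i, -, rfl⟩ | ⟨p, hp, i, rfl, -⟩ <;> exact Q.v_mem_vertices hp _
    have hadj : Q.diagGraph.Adj ⟨a, ha⟩ ⟨b, hb⟩ := ⟨fun h => hab.1 (congrArg Subtype.val h), hab.2⟩
    exact ⟨hb, (SimpleGraph.ConnectedComponent.mem_supp_congr_adj B hadj).1 haB⟩

open Classical in
/-- Extension by zero of a function on the vertices. -/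
noncomputable def extend (v : Q.vertices → ℝ) (z : ℂ) : ℝ :=
  if h : z ∈ Q.vertices then v ⟨z, h⟩ else 0

theorem extend_apply (v : Q.vertices → ℝ) (z : Q.vertices) : Q.extend v z = v z := by
  simp [extend]

theorem energy_eq (v : Q.vertices → ℝ) : Q.energy v = Q.planeEnergy (Q.extend v) := by
  rw [energy, planeEnergy, ← Finset.sum_coe_sort Q.faces]
  refine Finset.sum_congr rfl fun p _ => ?_
  congr 4
  funext i
  exact (Q.extend_apply v ⟨p.1.v i, Q.mem_vertices p i⟩).symm

open Classical in
theorem sqSum_eq (B : Q.diagGraph.ConnectedComponent) (K : Set ℂ) (u : B.supp → ℝ)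
    (v : Q.vertices → ℝ) (h : ∀ z : B.supp, v z = u z) :
    Q.sqSum B K u =
      ∑ z ∈ Q.vertices.filter fun z => z ∈ Q.componentSet B ∧ z ∈ K, Q.extend v z ^ 2 := by
  rw [sqSum, ← Finset.sum_filter]
  refine Finset.sum_bij (fun z _ => (z.1 : ℂ)) ?_ ?_ ?_ ?_
  · intro z hz
    exact Finset.mem_filter.2 ⟨z.1.2, ⟨z.1.2, z.2⟩, (Finset.mem_filter.1 hz).2⟩
  · intro a _ b _ hab
    exact Subtype.ext (Subtype.ext hab)
  · intro b hb
    obtain ⟨-, ⟨hbv, hbB⟩, hbK⟩ := Finset.mem_filter.1 hb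
    exact ⟨⟨⟨b, hbv⟩, hbB⟩, Finset.mem_filter.2 ⟨Finset.mem_univ _, hbK⟩, rfl⟩
  · intro z _
    rw [extend_apply, h]

end QuadLattice

theorem mainTheorem11 (Ω : Set ℂ) (hΩ_open : IsOpen Ω) (hΩ_bdd : Bornology.IsBounded Ω)
    (hΩ_sc : IsSimplyConnected Ω) (hΩ_smooth : HasSmoothBoundary Ω) (e : ℝ) :
    ∃ C : ℝ, 0 < C ∧
      ∀ (Q : QuadLattice), Q.eccentricity = e →
      ∀ (B : Q.diagGraph.ConnectedComponent) (K : Set ℂ), IsCompact K → K ⊆ Q.carrier →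
      ∀ r : ℝ, (∀ z ∈ Ω \ K, Metric.infDist z (frontier Ω) ≤ r) → Q.h < r →
        (∀ z ∈ Q.boundary, Metric.infDist z (frontier Ω) < r) →
      ∀ (u : B.supp → ℝ) (v : Q.vertices → ℝ), (∀ z : B.supp, v z = u z) →
        Q.h ^ 2 * Q.sqSum B (Ω \ K) u ≤
          C * (Q.h * r * Q.sqSum B Q.boundary u + r ^ 2 * Q.energy v) := by
  classical
  obtain ⟨N, M, hN, hM, hesc⟩ := exists_directions hΩ_open hΩ_bdd hΩ_sc hΩ_smooth
  set c := |e| + 1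
  have hc0 : 0 < c := by positivity
  set C₁ := 504 * c * M
  set C₂ := 128 * Real.pi * c ^ 2 * (252 * c) ^ 6 * M ^ 2
  have hC₁ : 0 ≤ C₁ := by positivity
  have hC₂ : 0 ≤ C₂ := by positivity
  refine ⟨N.card * (C₁ + C₂) + 1, by positivity, ?_⟩
  intro Q hQe B K _ _ r hKr hr hbd u v huv
  obtain ⟨D, hD⟩ : ∃ D, D = Ω \ K := ⟨_, rfl⟩
  rw [← hD] at hKr ⊢
  obtain ⟨z₀, -⟩ := B.nonempty_supp
  obtain ⟨p₀, hp₀, -⟩ := Q.mem_vertices_iff.1 z₀.2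
  have hQ : Q.NondegenerateUniform c :=
    Q.nondegenerateUniform_of_eccentricity_lt hp₀ (by
      rw [hQe]; exact (le_abs_self e).trans_lt (lt_add_one _))
  have hh := Q.h_pos hp₀
  have hr0 : 0 < r := hh.trans hr
  rw [Q.energy_eq, Q.sqSum_eq B _ u v huv, Q.sqSum_eq B _ u v huv]
  set f := Q.extend v
  set W := Q.vertices.filter fun z => z ∈ Q.componentSet B ∧ z ∈ D
  set S := ∑ z ∈ Q.vertices.filter fun z => z ∈ Q.componentSet B ∧ z ∈ Q.boundary, f z ^ 2
  have hS : 0 ≤ S := Finset.sum_nonneg fun _ _ => sq_nonneg _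
  have hE := Q.planeEnergy_nonneg f
  set P : ℂ → ℂ → Prop := fun n z =>
    ∀ x, dist x z ≤ Q.h → ∃ s ∈ Icc (0 : ℝ) (M * r), x + s • n ∉ Q.carrier
  have hcover : ∑ z ∈ W, f z ^ 2 ≤ ∑ n ∈ N, ∑ z ∈ W.filter (P n), f z ^ 2 := by
    simp_rw [Finset.sum_filter]
    rw [Finset.sum_comm]
    refine Finset.sum_le_sum fun z hz => ?_
    obtain ⟨-, -, hz⟩ := Finset.mem_filter.1 hz
    obtain ⟨n, hn, hP⟩ := hesc Q.carrier r Q.isCompact_carrier hr0 hbd z (hD ▸ hz).1 (hKr z hz)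
    have hPn : P n z := fun x hx => hP x (hx.trans hr.le)
    refine le_trans (le_of_eq (if_pos hPn).symm) (Finset.single_le_sum
      (f := fun n => if P n z then f z ^ 2 else 0) (fun k _ => ?_) hn)
    split_ifs
    · exact sq_nonneg _
    · exact le_rfl
  have hL : Q.h ≤ M * r := hr.le.trans (le_mul_of_one_le_left hr0.le hM)
  have hstrip : ∀ n ∈ N, Q.h ^ 2 * ∑ z ∈ W.filter (P n), f z ^ 2 ≤
      (C₁ + C₂) * (Q.h * r * S + r ^ 2 * Q.planeEnergy f) := by
    intro n hn
    have := Q.strip_inequality hQ (hN n hn) hL f (Q.componentSet B)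
      (fun z hz w hzw => Q.mem_componentSet_of_reachable B hz hzw) (W.filter (P n))
      ((Finset.filter_subset _ _).trans (Finset.filter_subset _ _))
      (fun z hz => (Finset.mem_filter.1 (Finset.mem_filter.1 hz).1).2.1)
      (fun z hz => (Finset.mem_filter.1 hz).2)
    calc _ ≤ _ := this
      _ = C₁ * (Q.h * r * S) + C₂ * (r ^ 2 * Q.planeEnergy f) := by
          simp only [C₁, C₂, S]; ring
      _ ≤ _ := by
          have a1 : 0 ≤ C₂ * (Q.h * r * S) := by positivity
          have a2 : 0 ≤ C₁ * (r ^ 2 * Q.planeEnergy f) := by positivity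
          linarith
  have hX : 0 ≤ Q.h * r * S + r ^ 2 * Q.planeEnergy f := by positivity
  calc Q.h ^ 2 * ∑ z ∈ W, f z ^ 2
      ≤ ∑ n ∈ N, Q.h ^ 2 * ∑ z ∈ W.filter (P n), f z ^ 2 := by
        rw [← Finset.mul_sum]
        gcongr
    _ ≤ ∑ _n ∈ N, (C₁ + C₂) * (Q.h * r * S + r ^ 2 * Q.planeEnergy f) := Finset.sum_le_sum hstrip
    _ = N.card * (C₁ + C₂) * (Q.h * r * S + r ^ 2 * Q.planeEnergy f) := by
        rw [Finset.sum_const, nsmul_eq_mul]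
        ring
    _ ≤ _ := by gcongr; exact (lt_add_one _).le
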